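/- Let $\Gamma$ be a hyperbolic group with identity $o$, and let $\hat d$ be a left-invariant metric on $\Gamma$ that is hyperbolic, quasi-isometric to a word metric, and strongly hyperbolic: there are $L\ge 0$, $s>0$, $R_0\ge 0$ such that for all $x,x',y,y'\in\Gamma$ and $R\ge R_0$, if $\hat d(x,y)-\hat d(x,x')-\hat d(y,y')+\hat d(x',y')\ge R$ then $|\hat d(x,y)-\hat d(x',y)-\hat d(x,y')+\hat d(x',y')|\le Le^{-sR}$. Let $\partial\Gamma$ be the boundary of $\Gamma$ (classes of divergent sequences for a word metric, with the topology given by the gauge $e^{-(\xi|\eta)_o}$), and $\partial^2\Gamma$ the set of ordered pairs of distinct boundary points. Put $\hat b_o(x,\xi)=\sup\{\limsup_n(\hat d(x,z_n)-\hat d(o,z_n)) : (z_n)\in\xi\}$ and $\alpha(x,\xi,\eta)=\tfrac12\big(\hat b_o(x^{-1},\xi)-\hat b_o(x^{-1},\eta)\big)$. Let $\mathcal F_\alpha=\Gamma\backslash(\partial^2\Gamma\times\mathbb R)$ be the quotient space for the action $x\cdot(\xi,\eta,t)=(x\xi,x\eta,t-\alpha(x,\xi,\eta))$, with the flow $\Phi_t[\xi,\eta,s]=[\xi,\eta,t+s]$.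 Let $S=S^{-1}$ be a finite set of generators of $\Gamma$, and let a strongly Markov automatic structure for $(\Gamma,S)$ be given: a finite directed graph with an initial vertex $s_*$ and a labelling $w$ of the edges by elements of $S$, such that every vertex can be reached from $s_*$ by a directed path, every directed path spells a geodesic of the Cayley graph, and $(e_0,\dots,e_{n-1})\mapsto w(e_0)\cdots w(e_{n-1})$ is a bijection from the directed paths issuing from $s_*$ onto $\Gamma$. Let $\Sigma$ be the space of bi-infinite directed paths $\omega=(\omega_i)_{i\in\mathbb Z}$, a subshift with shift $\sigma$. For $\omega\in\Sigma$ let $w_*(\omega)=(\xi_-(\omega),\xi_+(\omega))$ be the endpoints of the geodesic rays $o,w(\omega_{-1})^{-1},w(\omega_{-1})^{-1}w(\omega_{-2})^{-1},\dots$ and $o,w(\omega_0),w(\omega_0)w(\omega_1),\dots$. Put $\tilde\alpha(\omega)=\alpha(w(\omega_0)^{-1},w_*(\omega))$ and $S_N\tilde\alpha=\sum_{n=0}^{N-1}\tilde\alpha\circ\sigma^n$. Then $\xi_-(\omega)\ne\xi_+(\omega)$ for all $\omega\in\Sigma$, and there is an integer $N\ge1$ such that $S_N\tilde\alpha$ takes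 its values in $[c_1,c_2]$ for some $c_1,c_2>0$. For every such $N$, let $\mathrm{Sus}(\Sigma,S_N\tilde\alpha)$ be the quotient space of $\Sigma\times\mathbb R$ by the equivalence relation generated by $(\omega,t+S_N\tilde\alpha(\omega))\sim(\sigma^N\omega,t)$, with the suspension flow $\sigma_t[\omega,s]=[\omega,t+s]$. Then $$\Pi:\mathrm{Sus}(\Sigma,S_N\tilde\alpha)\to\mathcal F_\alpha,\qquad [\omega,t]\mapsto[w_*(\omega),t],$$ is a well-defined continuous map with $\Pi\circ\sigma_t=\Phi_t\circ\Pi$ for all $t\in\mathbb R$; it is surjective, and there is a constant $C\ge1$ such that $\Pi^{-1}(x)$ has at most $C$ elements for every $x\in\mathcal F_\alpha$. -/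

import Mathlib

open Filter Topology

noncomputable section

namespace FlowCoding

/-! ### Metrics on groups -/

/-- A left-invariant metric on a group. -/
structure LeftInvMetric (Γ : Type*) [Group Γ] where
  dist : Γ → Γ → ℝ
  dist_self : ∀ x, dist x x = 0
  eq_of_dist_eq_zero : ∀ x y, dist x y = 0 → x = y
  dist_comm : ∀ x y, dist x y = dist y x
  dist_triangle : ∀ x y z, dist x z ≤ dist x y + dist y z
  dist_mul_left : ∀ g x y, dist (g * x) (g * y) = dist x y

/-- A finite set of generators `S` with `S = S⁻¹`. -/
structure SymGenSet (Γ : Type*) [Group Γ] where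
  carrier : Finset Γ
  inv_mem : ∀ s ∈ carrier, s⁻¹ ∈ carrier
  closure_eq_top : Subgroup.closure (carrier : Set Γ) = ⊤

section Metrics

variable {Γ : Type*} [Group Γ]

/-- The Gromov product `(x | y)_w = (d(w, x) + d(w, y) - d(x, y)) / 2`. -/
def gromovProd (d : LeftInvMetric Γ) (w x y : Γ) : ℝ :=
  (d.dist w x + d.dist w y - d.dist x y) / 2

def IsHyperbolic (d : LeftInvMetric Γ) : Prop :=
  ∃ δ : ℝ, 0 ≤ δ ∧ ∀ x y z w : Γ,
    min (gromovProd d w x z) (gromovProd d w z y) - δ ≤ gromovProd d w x y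

def QuasiIsometric (d₁ d₂ : LeftInvMetric Γ) : Prop :=
  ∃ L C : ℝ, 0 < L ∧ 0 ≤ C ∧ ∀ x y : Γ,
    (1 / L) * d₁.dist x y - C ≤ d₂.dist x y ∧ d₂.dist x y ≤ L * d₁.dist x y + C

/-- Word length: the least `k` such that `x` is a product of `k` elements of `S`. -/
def wordLength (S : SymGenSet Γ) (x : Γ) : ℕ :=
  sInf {k : ℕ | ∃ l : List Γ, (∀ s ∈ l, s ∈ S.carrier) ∧ l.prod = x ∧ l.length = k}

theorem wordLength_spec (S : SymGenSet Γ) (x : Γ) :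
    ∃ l : List Γ, (∀ s ∈ l, s ∈ S.carrier) ∧ l.prod = x ∧ l.length = wordLength S x := by
  have hne : {k : ℕ | ∃ l : List Γ, (∀ s ∈ l, s ∈ S.carrier) ∧ l.prod = x ∧
      l.length = k}.Nonempty := by
    have hx : x ∈ Subgroup.closure (S.carrier : Set Γ) := by
      rw [S.closure_eq_top]; trivial
    rw [← Subgroup.mem_toSubmonoid, Subgroup.closure_toSubmonoid] at hx
    obtain ⟨l, hl, hp⟩ := Submonoid.exists_list_of_mem_closure hx
    refine ⟨l.length, l, fun s hs => ?_, hp, rfl⟩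
    rcases hl s hs with h | h
    · exact h
    · simpa using S.inv_mem _ h
  exact Nat.sInf_mem hne

theorem wordLength_le (S : SymGenSet Γ) (l : List Γ) (hl : ∀ s ∈ l, s ∈ S.carrier) :
    wordLength S l.prod ≤ l.length :=
  Nat.sInf_le ⟨l, hl, rfl, rfl⟩

theorem wordLength_one (S : SymGenSet Γ) : wordLength S (1 : Γ) = 0 := by
  have := wordLength_le S [] (by simp)
  simpa using this

theorem wordLength_mul (S : SymGenSet Γ) (x y : Γ) :
    wordLength S (x * y) ≤ wordLength S x + wordLength S y := by
  obtain ⟨l, hl, rfl, h1⟩ := wordLength_spec S x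
  obtain ⟨m, hm, rfl, h2⟩ := wordLength_spec S y
  rw [← h1, ← h2, ← List.prod_append, ← List.length_append]
  apply wordLength_le
  intro s hs
  rcases List.mem_append.1 hs with h | h
  · exact hl s h
  · exact hm s h

theorem wordLength_inv_le (S : SymGenSet Γ) (x : Γ) :
    wordLength S x⁻¹ ≤ wordLength S x := by
  obtain ⟨l, hl, rfl, h1⟩ := wordLength_spec S x
  rw [← h1, List.prod_inv_reverse]
  refine (wordLength_le S _ ?_).trans (by simp)
  intro s hs
  simp only [List.mem_reverse, List.mem_map] at hs
  obtain ⟨a, ha, rfl⟩ := hs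
  exact S.inv_mem _ (hl a ha)

theorem wordLength_inv (S : SymGenSet Γ) (x : Γ) :
    wordLength S x⁻¹ = wordLength S x :=
  le_antisymm (wordLength_inv_le S x) (by simpa using wordLength_inv_le S x⁻¹)

/-- The word metric `d_S(x, y) = |x⁻¹ y|_S`. -/
def wordMetric (S : SymGenSet Γ) : LeftInvMetric Γ where
  dist x y := (wordLength S (x⁻¹ * y) : ℝ)
  dist_self x := by simp [wordLength_one]
  eq_of_dist_eq_zero x y h := by
    obtain ⟨l, -, hp, hlen⟩ := wordLength_spec S (x⁻¹ * y)
    have h0 : wordLength S (x⁻¹ * y) = 0 := by exact_mod_cast h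
    rw [h0, List.length_eq_zero_iff] at hlen
    subst hlen
    simp only [List.prod_nil] at hp
    exact (inv_mul_eq_one.1 hp.symm)
  dist_comm x y := by
    have := wordLength_inv S (x⁻¹ * y)
    rw [mul_inv_rev, inv_inv] at this
    rw [this]
  dist_triangle x y z := by
    have := wordLength_mul S (x⁻¹ * y) (y⁻¹ * z)
    rw [show x⁻¹ * y * (y⁻¹ * z) = x⁻¹ * z by group] at this
    exact_mod_cast this
  dist_mul_left g x y := by
    rw [show (g * x)⁻¹ * (g * y) = x⁻¹ * y by group]

variable (Γ) in
/-- A hyperbolic group: a finitely generated group some word metric of which is hyperbolic. -/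
def IsHyperbolicGroup : Prop :=
  ∃ S : SymGenSet Γ, IsHyperbolic (wordMetric S)

/-- The class of left-invariant hyperbolic metrics that are quasi-isometric to a word metric. -/
def IsAdmissible (d : LeftInvMetric Γ) : Prop :=
  IsHyperbolic d ∧ ∃ S : SymGenSet Γ, QuasiIsometric d (wordMetric S)

/-- Strong hyperbolicity. -/
def IsStronglyHyperbolic (d : LeftInvMetric Γ) : Prop :=
  IsHyperbolic d ∧ ∃ L s R₀ : ℝ, 0 ≤ L ∧ 0 < s ∧ 0 ≤ R₀ ∧
    ∀ (x x' y y' : Γ) (R : ℝ), R₀ ≤ R →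
      R ≤ d.dist x y - d.dist x x' - d.dist y y' + d.dist x' y' →
      |d.dist x y - d.dist x' y - d.dist x y' + d.dist x' y'| ≤ L * Real.exp (-s * R)

/-! ### The boundary at infinity -/

/-- The condition `(xₙ | yₘ)_o → ∞` as `n, m → ∞`, with base point the identity. -/
def TendToSamePoint (d : LeftInvMetric Γ) (x y : ℕ → Γ) : Prop :=
  Tendsto (fun p : ℕ × ℕ => gromovProd d 1 (x p.1) (y p.2)) atTop atTop

/-- Divergent sequences: `(xₙ | xₘ)_o → ∞` as `n, m → ∞`. -/
def DivergentSeq (d : LeftInvMetric Γ) : Type _ :=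
  {x : ℕ → Γ // TendToSamePoint d x x}

/-- The boundary: divergent sequences modulo `(xₙ | yₘ)_o → ∞`. (For hyperbolic `d` this
relation is already an equivalence relation; in general `Quot` passes to the generated one.) -/
def Boundary (d : LeftInvMetric Γ) : Type _ :=
  Quot (fun x y : DivergentSeq d => TendToSamePoint d x.1 y.1)

def Boundary.mk (d : LeftInvMetric Γ) (x : DivergentSeq d) : Boundary d := Quot.mk _ x

/-- The Gromov product of boundary points: the supremum of `liminf (xₙ | yₙ)_o` over sequences
`x ∈ ξ` and `y ∈ η`; it is `⊤` when `ξ = η`. -/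
def boundaryProd (d : LeftInvMetric Γ) (ξ η : Boundary d) : EReal :=
  sSup {r : EReal | ∃ x y : DivergentSeq d, Boundary.mk d x = ξ ∧ Boundary.mk d y = η ∧
    r = liminf (fun n => ((gromovProd d 1 (x.1 n) (y.1 n) : ℝ) : EReal)) atTop}

/-- The topology of the gauge `ρ(ξ, η) = exp (-(ξ | η)_o)`: a set is open if with each point `ξ`
it contains a ball `{η | ρ(ξ, η) < exp (-R)}`. -/
instance (d : LeftInvMetric Γ) : TopologicalSpace (Boundary d) where
  IsOpen U := ∀ ξ ∈ U, ∃ R : ℝ, ∀ η, (R : EReal) < boundaryProd d ξ η → η ∈ U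
  isOpen_univ := fun _ _ => ⟨0, fun _ _ => trivial⟩
  isOpen_inter := by
    rintro U W hU hW ξ ⟨h1, h2⟩
    obtain ⟨R, hR⟩ := hU ξ h1
    obtain ⟨R', hR'⟩ := hW ξ h2
    refine ⟨max R R', fun η h => ⟨hR η (lt_of_le_of_lt ?_ h), hR' η (lt_of_le_of_lt ?_ h)⟩⟩
    · exact_mod_cast le_max_left R R'
    · exact_mod_cast le_max_right R R'
  isOpen_sUnion := by
    rintro s hs ξ ⟨U, hU, hξ⟩
    obtain ⟨R, hR⟩ := hs U hU ξ hξ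
    exact ⟨R, fun η h => ⟨U, hU, hR η h⟩⟩

theorem TendToSamePoint.mul_left {d : LeftInvMetric Γ} {x y : ℕ → Γ}
    (h : TendToSamePoint d x y) (g : Γ) :
    TendToSamePoint d (fun n => g * x n) (fun n => g * y n) := by
  unfold TendToSamePoint at h ⊢
  refine tendsto_atTop_mono (fun p => ?_) (tendsto_atTop_add_const_right _ (-(d.dist 1 g)) h)
  have hl := d.dist_mul_left g (x p.1) (y p.2)
  have h1 := d.dist_triangle g 1 (g * x p.1)
  have h2 := d.dist_triangle g 1 (g * y p.2)
  have h3 := d.dist_mul_left g 1 (x p.1)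
  have h4 := d.dist_mul_left g 1 (y p.2)
  have h5 := d.dist_comm g 1
  rw [mul_one] at h3 h4
  simp only [gromovProd]
  linarith

/-- The action of the group on its boundary by left multiplication. -/
instance (d : LeftInvMetric Γ) : MulAction Γ (Boundary d) where
  smul g := Quot.map (fun x => ⟨fun n => g * x.1 n, x.2.mul_left g⟩) (fun _ _ h => h.mul_left g)
  one_smul ξ := by
    induction ξ using Quot.ind with
    | mk x =>
      refine congrArg (Quot.mk _) (Subtype.ext (funext fun n => ?_))
      exact one_mul _
  mul_smul g h ξ := by
    induction ξ using Quot.ind with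
    | mk x =>
      refine congrArg (Quot.mk _) (Subtype.ext (funext fun n => ?_))
      exact mul_assoc _ _ _

/-- Ordered pairs of distinct boundary points (with the subspace topology). -/
abbrev BoundaryPairs (d : LeftInvMetric Γ) : Type _ :=
  {p : Boundary d × Boundary d // p.1 ≠ p.2}

/-! ### The flow space

The boundary of the group is realised through a word metric `wordMetric S`, and `d` is the metric
through which the Busemann function and the cocycle are defined. -/

/-- The Busemann function based at the identity:
`b_o(x, ξ) = sup {limsup (d(x, zₙ) - d(o, zₙ)) | z ∈ ξ}`. -/
def busemann (S : SymGenSet Γ) (d : LeftInvMetric Γ) (x : Γ) (ξ : Boundary (wordMetric S)) : ℝ :=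
  sSup {r : ℝ | ∃ z : DivergentSeq (wordMetric S), Boundary.mk _ z = ξ ∧
    r = limsup (fun n => d.dist x (z.1 n) - d.dist 1 (z.1 n)) atTop}

/-- The cocycle `α(x, ξ, η) = (b_o(x⁻¹, ξ) - b_o(x⁻¹, η)) / 2`. -/
def cocycle (S : SymGenSet Γ) (d : LeftInvMetric Γ) (x : Γ)
    (p : Boundary (wordMetric S) × Boundary (wordMetric S)) : ℝ :=
  (1 / 2) * (busemann S d x⁻¹ p.1 - busemann S d x⁻¹ p.2)

/-- The space `∂²Γ × ℝ`. -/
abbrev LineSpace (S : SymGenSet Γ) : Type _ := BoundaryPairs (wordMetric S) × ℝ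

/-- `x · (ξ, η, t) = (x ξ, x η, t - α(x, ξ, η))`. -/
def lineAct (S : SymGenSet Γ) (d : LeftInvMetric Γ) (x : Γ) (q : LineSpace S) : LineSpace S :=
  (⟨(x • q.1.1.1, x • q.1.1.2), fun h => q.1.2 (smul_left_cancel x h)⟩,
    q.2 - cocycle S d x q.1.1)

/-- The flow space: the quotient of `∂²Γ × ℝ` obtained by identifying `q` with `x · q` for all
`x`, with the quotient topology. -/
def FlowSpace (S : SymGenSet Γ) (d : LeftInvMetric Γ) : Type _ :=
  Quot (fun q q' : LineSpace S => ∃ x : Γ, q' = lineAct S d x q)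

instance (S : SymGenSet Γ) (d : LeftInvMetric Γ) : TopologicalSpace (FlowSpace S d) :=
  inferInstanceAs (TopologicalSpace (Quot _))

/-- The class `[ξ, η, t]`. -/
def FlowSpace.mk (S : SymGenSet Γ) (d : LeftInvMetric Γ) (q : LineSpace S) : FlowSpace S d :=
  Quot.mk _ q

/-- The flow `Φ_t [ξ, η, s] = [ξ, η, t + s]`. -/
def FlowSpace.flow (S : SymGenSet Γ) (d : LeftInvMetric Γ) (t : ℝ) :
    FlowSpace S d → FlowSpace S d :=
  Quot.map (fun q => (q.1, t + q.2)) (by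
    rintro q q' ⟨x, rfl⟩
    exact ⟨x, Prod.ext rfl (by simp only [lineAct]; ring)⟩)

end Metrics

/-! ### Automatic structures -/

/-- A directed graph with vertices `V` and edges `E`, an initial state, and a labelling of the edges
by elements of `S`. -/
structure Automaton {Γ : Type*} [Group Γ] (S : SymGenSet Γ) (V E : Type*) where
  src : E → V
  tgt : E → V
  init : V
  label : E → Γ
  label_mem : ∀ e, label e ∈ S.carrier

section Automata

variable {Γ : Type*} [Group Γ] {S : SymGenSet Γ} {V E : Type*}

/-- Finite directed paths, as lists of edges. -/
def Automaton.IsPath (A : Automaton S V E) (l : List E) : Prop :=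
  l.IsChain (fun e e' => A.tgt e = A.src e')

/-- Finite directed paths issuing from the initial state (including the empty one). -/
def Automaton.IsInitialPath (A : Automaton S V E) (l : List E) : Prop :=
  A.IsPath l ∧ ∀ e ∈ l.head?, A.src e = A.init

/-- The final vertex of a path from the initial state. -/
def Automaton.endVertex (A : Automaton S V E) (l : List E) : V :=
  (l.getLast?.map A.tgt).getD A.init

/-- `w_*(e₀, …, eₙ₋₁) = w(e₀) ⋯ w(eₙ₋₁)`. -/
def Automaton.terminus (A : Automaton S V E) (l : List E) : Γ :=
  (l.map A.label).prod

end Automata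

/-- Strongly Markov automatic structures. -/
structure StronglyMarkov {Γ : Type*} [Group Γ] (S : SymGenSet Γ) (V E : Type*)
    extends Automaton S V E where
  reachable : ∀ v : V, ∃ l, toAutomaton.IsInitialPath l ∧ toAutomaton.endVertex l = v
  geodesic : ∀ l, toAutomaton.IsPath l → ∀ i j, i ≤ j → j ≤ l.length →
    (wordMetric S).dist (toAutomaton.terminus (l.take i)) (toAutomaton.terminus (l.take j))
      = (j : ℝ) - i
  bijective : Set.BijOn toAutomaton.terminus {l | toAutomaton.IsInitialPath l} Set.univ

section Coding

variable {Γ : Type*} [Group Γ] {S : SymGenSet Γ} {V E : Type*}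

/-- The space of bilateral directed paths. -/
def BiPath (A : StronglyMarkov S V E) : Type _ :=
  {ω : ℤ → E // ∀ i, A.tgt (ω i) = A.src (ω (i + 1))}

/-- The topology of a subshift: induced by the product topology of discrete spaces. -/
instance (A : StronglyMarkov S V E) : TopologicalSpace (BiPath A) :=
  TopologicalSpace.induced Subtype.val (@Pi.topologicalSpace ℤ (fun _ => E) (fun _ => ⊥))

/-- The shift `(σ ω)ᵢ = ωᵢ₊₁`. -/
def shift (A : StronglyMarkov S V E) (ω : BiPath A) : BiPath A :=
  ⟨fun i => ω.1 (i + 1), fun i => ω.2 (i + 1)⟩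

/-- The points `o, w(ω₀), w(ω₀)w(ω₁), …`. -/
def fwd (A : StronglyMarkov S V E) (ω : BiPath A) : ℕ → Γ
  | 0 => 1
  | n + 1 => fwd A ω n * A.label (ω.1 n)

/-- The points `o, w(ω₋₁)⁻¹, w(ω₋₁)⁻¹w(ω₋₂)⁻¹, …`. -/
def bwd (A : StronglyMarkov S V E) (ω : BiPath A) : ℕ → Γ
  | 0 => 1
  | n + 1 => bwd A ω n * (A.label (ω.1 (-((n : ℤ) + 1))))⁻¹

/-- The edges `ω_z, …, ω_{z+n-1}`. -/
def segment (A : StronglyMarkov S V E) (ω : BiPath A) (z : ℤ) (n : ℕ) : List E :=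
  (List.range n).map (fun k : ℕ => ω.1 (z + k))

theorem segment_length (A : StronglyMarkov S V E) (ω : BiPath A) (z : ℤ) (n : ℕ) :
    wordLength S (A.terminus (segment A ω z n)) = n := by
  have hp : A.IsPath (segment A ω z n) := by
    unfold Automaton.IsPath segment
    rw [List.isChain_iff_getElem]
    intro i hi
    simp only [List.getElem_map, List.getElem_range]
    rw [ω.2]
    push_cast
    rw [add_assoc]
  have h := A.geodesic _ hp 0 n (Nat.zero_le _) (by simp [segment])
  have ht : (segment A ω z n).take n = segment A ω z n :=
    List.take_of_length_le (by simp [segment])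
  rw [ht] at h
  simp only [wordMetric, Automaton.terminus, List.take_zero, List.map_nil, List.prod_nil, inv_one,
    one_mul, Nat.cast_zero, sub_zero] at h
  exact_mod_cast h

theorem fwd_add (A : StronglyMarkov S V E) (ω : BiPath A) (m n : ℕ) :
    fwd A ω (m + n) = fwd A ω m * A.terminus (segment A ω m n) := by
  induction n with
  | zero => simp [segment, Automaton.terminus]
  | succ n ih =>
    rw [← add_assoc, fwd, ih]
    simp [segment, Automaton.terminus, List.range_succ, mul_assoc]

theorem bwd_add (A : StronglyMarkov S V E) (ω : BiPath A) (m n : ℕ) :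
    bwd A ω (m + n) = bwd A ω m * (A.terminus (segment A ω (-((m : ℤ) + n)) n))⁻¹ := by
  induction n with
  | zero => simp [segment, Automaton.terminus]
  | succ n ih =>
    rw [← add_assoc, bwd, ih, mul_assoc, ← mul_inv_rev]
    simp only [segment, Automaton.terminus, List.range_succ_eq_map, List.map_cons, List.map_map,
      List.prod_cons]
    have h0 : -((m : ℤ) + ((n + 1 : ℕ) : ℤ)) + ((0 : ℕ) : ℤ) = -(((m + n : ℕ) : ℤ) + 1) := by
      push_cast; ring
    have hk : ∀ k : ℕ, -((m : ℤ) + ((n + 1 : ℕ) : ℤ)) + ((k.succ : ℕ) : ℤ)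
        = -((m : ℤ) + n) + k := fun k => by push_cast; ring
    simp only [Function.comp_def, h0, hk]

theorem tendToSamePoint_of_ray (x : ℕ → Γ) (h0 : x 0 = 1)
    (h : ∀ m n : ℕ, (wordMetric S).dist (x m) (x (m + n)) = n) :
    TendToSamePoint (wordMetric S) x x := by
  have hp : ∀ p : ℕ × ℕ, gromovProd (wordMetric S) 1 (x p.1) (x p.2) = ((min p.1 p.2 : ℕ) : ℝ) := by
    rintro ⟨a, b⟩
    have ha := h 0 a
    have hb := h 0 b
    rw [zero_add, h0] at ha hb
    simp only [gromovProd]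
    rcases le_total a b with hab | hab
    · obtain ⟨c, rfl⟩ := Nat.exists_eq_add_of_le hab
      rw [ha, hb, h a c, min_eq_left hab]; push_cast; ring
    · obtain ⟨c, rfl⟩ := Nat.exists_eq_add_of_le hab
      rw [ha, hb, (wordMetric S).dist_comm, h b c, min_eq_right hab]; push_cast; ring
  unfold TendToSamePoint
  simp_rw [hp]
  refine tendsto_natCast_atTop_atTop.comp (tendsto_atTop.2 fun b => ?_)
  filter_upwards [eventually_ge_atTop (b, b)] with p hp
  exact le_min hp.1 hp.2

theorem fwd_ray (A : StronglyMarkov S V E) (ω : BiPath A) (m n : ℕ) :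
    (wordMetric S).dist (fwd A ω m) (fwd A ω (m + n)) = n := by
  rw [fwd_add]
  simp [wordMetric, segment_length]

theorem bwd_ray (A : StronglyMarkov S V E) (ω : BiPath A) (m n : ℕ) :
    (wordMetric S).dist (bwd A ω m) (bwd A ω (m + n)) = n := by
  rw [bwd_add]
  simp [wordMetric, wordLength_inv, segment_length]

/-- The extreme `ξ₋(ω)` of the geodesic ray `bwd`. -/
def xiMinus (A : StronglyMarkov S V E) (ω : BiPath A) : Boundary (wordMetric S) :=
  Boundary.mk _ ⟨bwd A ω, tendToSamePoint_of_ray _ rfl (bwd_ray A ω)⟩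

/-- The extreme `ξ₊(ω)` of the geodesic ray `fwd`. -/
def xiPlus (A : StronglyMarkov S V E) (ω : BiPath A) : Boundary (wordMetric S) :=
  Boundary.mk _ ⟨fwd A ω, tendToSamePoint_of_ray _ rfl (fwd_ray A ω)⟩

/-- `w_*(ω) = (ξ₋(ω), ξ₊(ω))`. -/
def wStar (A : StronglyMarkov S V E) (ω : BiPath A) :
    Boundary (wordMetric S) × Boundary (wordMetric S) :=
  (xiMinus A ω, xiPlus A ω)

/-- The function `α̃(ω) = α(w(ω₀)⁻¹, w_*(ω))`. -/
def alphaTilde (A : StronglyMarkov S V E) (d : LeftInvMetric Γ) (ω : BiPath A) : ℝ :=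
  cocycle S d (A.label (ω.1 0))⁻¹ (wStar A ω)

/-- The Birkhoff sum `S_N α̃ (ω) = ∑_{n < N} α̃ (σⁿ ω)`. -/
def roof (A : StronglyMarkov S V E) (d : LeftInvMetric Γ) (N : ℕ) (ω : BiPath A) : ℝ :=
  ∑ n ∈ Finset.range N, alphaTilde A d ((shift A)^[n] ω)

/-- `N ≥ 1` and `S_N α̃` takes its values in a compact interval of positive numbers. -/
def IsRoofTime (A : StronglyMarkov S V E) (d : LeftInvMetric Γ) (N : ℕ) : Prop :=
  1 ≤ N ∧ ∃ c₁ c₂ : ℝ, 0 < c₁ ∧ 0 < c₂ ∧ ∀ ω : BiPath A, roof A d N ω ∈ Set.Icc c₁ c₂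

/-- The suspension: `Σ × ℝ` modulo `(ω, t + S_N α̃(ω)) ∼ (σ^N ω, t)`, with the quotient topology. -/
def Suspension (A : StronglyMarkov S V E) (d : LeftInvMetric Γ) (N : ℕ) : Type _ :=
  Quot (fun p q : BiPath A × ℝ => ∃ (ω : BiPath A) (t : ℝ),
    p = (ω, t + roof A d N ω) ∧ q = ((shift A)^[N] ω, t))

instance (A : StronglyMarkov S V E) (d : LeftInvMetric Γ) (N : ℕ) :
    TopologicalSpace (Suspension A d N) :=
  inferInstanceAs (TopologicalSpace (Quot _))

/-- The class `[ω, t]`. -/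
def Suspension.mk (A : StronglyMarkov S V E) (d : LeftInvMetric Γ) (N : ℕ) (ω : BiPath A) (t : ℝ) :
    Suspension A d N :=
  Quot.mk _ (ω, t)

/-- The suspension flow `σ_t [ω, s] = [ω, t + s]`. -/
def Suspension.flow (A : StronglyMarkov S V E) (d : LeftInvMetric Γ) (N : ℕ) (t : ℝ) :
    Suspension A d N → Suspension A d N :=
  Quot.map (fun p => (p.1, t + p.2)) (by
    rintro p q ⟨ω, s, rfl, rfl⟩
    exact ⟨ω, t + s, Prod.ext rfl (by simp only []; ring), rfl⟩)

end Coding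

end FlowCoding

end

open FlowCoding

/-! A bilateral path of the automaton spells a bi-infinite word geodesic through the identity.
Because `α` is a cocycle, translating by `(fwd A ω N)⁻¹` shifts the path by `N` and subtracts `S_N
α̃(ω)` from the time (`wStar_shift_iterate`, `roof_eq_cocycle`); this is the identification made in
the suspension, so the coding descends. Strong hyperbolicity enters here: it turns the limsups in
the Busemann function into limits that do not depend on the sequence (`tendsto_busemann`), so that
`α` satisfies the cocycle identity exactly.

The metric estimates use the hyperbolicity of `d`, carried over to word geodesics by a Morse lemma
(`exists_gromovProd_le_of_geodesic`): seen from a point of a word geodesic, its two ends have a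
bounded `d`-Gromov product. Hence the Gromov products of `d` and of the word metric are comparable,
and both metrics see the same boundary. Hence also `ξ₋ ≠ ξ₊`, and `S_N α̃(ω)` differs from `d(o, fwd
A ω N)` by a bounded amount, so it is positive for large `N`.

Surjectivity is a compactness argument (`exists_smul_wStar`): automaton paths joining points near
`ξ` to points near `η` pass within bounded distance of the identity, and they accumulate on a
translated bilateral path.

For the fibres, a point of the suspension has a representative with time in `[0, c₂]`. Two such
representatives in one fibre differ by an element `g` with bounded cocycle, and such a `g` is
bounded (`exists_dist_le_of_cocycle_le`). The rays then fellow travel. Since the automaton spells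
each element only once from a given vertex, a long segment is determined by its two ends and its
first vertex, which leaves boundedly many choices (`exists_encard_le`). -/

namespace FlowCoding

/-! ### Gromov products -/

section GromovProduct

variable {Γ : Type*} [Group Γ] (d : LeftInvMetric Γ)

theorem LeftInvMetric.dist_nonneg (x y : Γ) : 0 ≤ d.dist x y := by
  have := d.dist_triangle x y x
  rw [d.dist_self, d.dist_comm y x] at this
  linarith

theorem gromovProd_comm (w x y : Γ) : gromovProd d w x y = gromovProd d w y x := by
  simp only [gromovProd, d.dist_comm x y]; ring

theorem gromovProd_nonneg (w x y : Γ) : 0 ≤ gromovProd d w x y := by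
  have := d.dist_triangle x w y
  rw [d.dist_comm x w] at this
  simp only [gromovProd]; linarith

theorem gromovProd_le_dist_left (w x y : Γ) : gromovProd d w x y ≤ d.dist w x := by
  have := d.dist_triangle w x y
  simp only [gromovProd]; linarith

theorem gromovProd_le_dist_right (w x y : Γ) : gromovProd d w x y ≤ d.dist w y := by
  rw [gromovProd_comm]; exact gromovProd_le_dist_left d w y x

theorem dist_sub_dist_le_gromovProd (w x y : Γ) :
    d.dist w x - d.dist x y ≤ gromovProd d w x y := by
  have := d.dist_triangle w y x
  rw [d.dist_comm y x] at this
  simp only [gromovProd]; linarith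

theorem gromovProd_le_add_dist_base (w w' x y : Γ) :
    gromovProd d w x y ≤ gromovProd d w' x y + d.dist w w' := by
  have h1 := d.dist_triangle w w' x
  have h2 := d.dist_triangle w w' y
  simp only [gromovProd]; linarith

theorem gromovProd_le_add_dist_right (w x y y' : Γ) :
    gromovProd d w x y ≤ gromovProd d w x y' + d.dist y y' := by
  have h1 := d.dist_triangle w y' y
  have h2 := d.dist_triangle x y y'
  rw [d.dist_comm y' y] at h1
  simp only [gromovProd]; linarith

theorem gromovProd_le_add_dist_left (w x x' y : Γ) :
    gromovProd d w x y ≤ gromovProd d w x' y + d.dist x x' := by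
  rw [gromovProd_comm d w x, gromovProd_comm d w x']
  exact gromovProd_le_add_dist_right d w y x x'

theorem gromovProd_mul_left (g w x y : Γ) :
    gromovProd d (g * w) (g * x) (g * y) = gromovProd d w x y := by
  simp only [gromovProd, d.dist_mul_left]

theorem gromovProd_self (w x : Γ) : gromovProd d w x x = d.dist w x := by
  simp only [gromovProd, d.dist_self]; ring

end GromovProduct

/-! ### Word geodesics -/

section WordGeodesic

variable {Γ : Type*} [Group Γ]

/-- The points `x 0, …, x n` form a geodesic of the Cayley graph. -/
def IsWordGeodesic (S : SymGenSet Γ) (x : ℕ → Γ) (n : ℕ) : Prop :=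
  ∀ i j, i ≤ j → j ≤ n → (wordMetric S).dist (x i) (x j) = (j : ℝ) - i

variable {S : SymGenSet Γ}

theorem IsWordGeodesic.mono {x : ℕ → Γ} {m n : ℕ} (hx : IsWordGeodesic S x n) (hmn : m ≤ n) :
    IsWordGeodesic S x m :=
  fun i j hij hj => hx i j hij (hj.trans hmn)

theorem IsWordGeodesic.shift {x : ℕ → Γ} {m n : ℕ} (hx : IsWordGeodesic S x (m + n)) :
    IsWordGeodesic S (fun i => x (m + i)) n := by
  intro i j hij hj
  rw [hx (m + i) (m + j) (by omega) (by omega)]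
  push_cast; ring

theorem IsWordGeodesic.reverse {x : ℕ → Γ} {n : ℕ} (hx : IsWordGeodesic S x n) :
    IsWordGeodesic S (fun i => x (n - i)) n := by
  intro i j hij hj
  rw [(wordMetric S).dist_comm, hx (n - j) (n - i) (by omega) (by omega),
    Nat.cast_sub hj, Nat.cast_sub (hij.trans hj)]
  ring

theorem IsWordGeodesic.mul_left {x : ℕ → Γ} {n : ℕ} (hx : IsWordGeodesic S x n) (g : Γ) :
    IsWordGeodesic S (fun i => g * x i) n := by
  intro i j hij hj
  rw [(wordMetric S).dist_mul_left, hx i j hij hj]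

theorem IsWordGeodesic.gromovProd_eq_zero {x : ℕ → Γ} {n p : ℕ} (hx : IsWordGeodesic S x n)
    (hp : p ≤ n) : gromovProd (wordMetric S) (x p) (x 0) (x n) = 0 := by
  rw [gromovProd, (wordMetric S).dist_comm, hx 0 p (Nat.zero_le _) hp, hx p n hp le_rfl,
    hx 0 n (Nat.zero_le _) le_rfl]
  push_cast; ring

theorem exists_isWordGeodesic (S : SymGenSet Γ) (x y : Γ) :
    ∃ (u : ℕ → Γ) (n : ℕ), IsWordGeodesic S u n ∧ u 0 = x ∧ u n = y := by
  obtain ⟨l, hl, hp, hlen⟩ := wordLength_spec S (x⁻¹ * y)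
  have key : ∀ i j, i ≤ j → j ≤ l.length →
      (wordMetric S).dist (x * (l.take i).prod) (x * (l.take j).prod) ≤ (j : ℝ) - i := by
    intro i j hij hj
    rw [(wordMetric S).dist_mul_left]
    have hsplit : (l.take j).prod = (l.take i).prod * ((l.take j).drop i).prod := by
      rw [← List.prod_append]
      congr 1
      conv_lhs => rw [← List.take_append_drop i (l.take j)]
      rw [List.take_take, min_eq_left hij]
    have hle := wordLength_le S ((l.take j).drop i)
      (fun s hs => hl s (List.mem_of_mem_take (List.mem_of_mem_drop hs)))
    rw [List.length_drop, List.length_take, min_eq_left hj] at hle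
    simp only [wordMetric, hsplit, inv_mul_cancel_left]
    rw [← Nat.cast_sub hij]
    exact_mod_cast hle
  refine ⟨fun i => x * (l.take i).prod, l.length, fun i j hij hj => ?_, by simp, by simp [hp]⟩
  -- The three pieces cut by `i` and `j` satisfy the upper bounds and must add up to the word
  -- length, so none of them can be shorter.
  refine le_antisymm (key i j hij hj) ?_
  have h1 := key 0 i (Nat.zero_le _) (hij.trans hj)
  have h2 := key j l.length hj le_rfl
  have h3 := (wordMetric S).dist_triangle (x * (l.take 0).prod) (x * (l.take i).prod)
    (x * (l.take l.length).prod)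
  have h4 := (wordMetric S).dist_triangle (x * (l.take i).prod) (x * (l.take j).prod)
    (x * (l.take l.length).prod)
  have h5 : (wordMetric S).dist (x * (l.take 0).prod) (x * (l.take l.length).prod) = l.length := by
    rw [List.take_length]
    simp [wordMetric, hp, hlen]
  push_cast at h1
  linarith

/-- A left-invariant metric is bounded by a multiple of a word metric. -/
theorem exists_dist_le_mul_wordMetric (S : SymGenSet Γ) (d : LeftInvMetric Γ) :
    ∃ M : ℝ, 1 ≤ M ∧ ∀ x y, d.dist x y ≤ M * (wordMetric S).dist x y := by
  obtain ⟨B, hB⟩ : ∃ B : ℝ, ∀ s ∈ S.carrier, d.dist 1 s ≤ B := by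
    obtain ⟨B, hB⟩ := (S.carrier.image (fun s => d.dist 1 s)).bddAbove
    exact ⟨B, fun s hs => hB (by simpa using ⟨s, hs, rfl⟩)⟩
  refine ⟨max 1 B, le_max_left _ _, fun x y => ?_⟩
  have key : ∀ l : List Γ, (∀ s ∈ l, s ∈ S.carrier) → d.dist 1 l.prod ≤ max 1 B * l.length := by
    intro l
    induction l with
    | nil => intro _; simp [d.dist_self]
    | cons a l ih =>
      intro hl
      have h1 := ih (fun s hs => hl s (List.mem_cons_of_mem _ hs))
      have h2 := hB a (hl a List.mem_cons_self)
      have h3 := d.dist_triangle 1 a (a * l.prod)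
      have h4 := d.dist_mul_left a 1 l.prod
      rw [mul_one] at h4
      rw [List.prod_cons, List.length_cons]
      push_cast
      have := le_max_right 1 B
      linarith
  obtain ⟨l, hl, hp, hlen⟩ := wordLength_spec S (x⁻¹ * y)
  have h := key l hl
  rw [hp, hlen, ← d.dist_mul_left x, mul_one, mul_inv_cancel_left] at h
  exact h

end WordGeodesic

/-! ### Hyperbolic metrics comparable with a word metric -/

section Comparison

variable {Γ : Type*} [Group Γ]

/-- The metric `d` is `δ`-hyperbolic, and it is quasi-isometric to the word metric of `S`. -/
structure HypComparison (S : SymGenSet Γ) (d : LeftInvMetric Γ) (δ M c : ℝ) : Prop where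
  delta_nonneg : 0 ≤ δ
  hyp : ∀ x y z w : Γ, min (gromovProd d w x z) (gromovProd d w z y) - δ ≤ gromovProd d w x y
  one_le : 1 ≤ M
  nonneg : 0 ≤ c
  dist_le : ∀ x y, d.dist x y ≤ M * (wordMetric S).dist x y
  word_le : ∀ x y, (wordMetric S).dist x y ≤ M * d.dist x y + c

/-- The generating set `S'` in the hypothesis need not be `S`; the word metric of `S` is at most a
multiple of that of `S'`. The upper bound for `d` comes from left invariance and needs no additive
constant. -/
theorem IsAdmissible.exists_hypComparison {d : LeftInvMetric Γ} (hd : IsAdmissible d)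
    (S : SymGenSet Γ) : ∃ δ M c : ℝ, HypComparison S d δ M c := by
  obtain ⟨⟨δ, hδ, hyp⟩, S', L, C, hL, hC, hq⟩ := hd
  obtain ⟨M₁, hM₁, h₁⟩ := exists_dist_le_mul_wordMetric S d
  obtain ⟨M₂, hM₂, h₂⟩ := exists_dist_le_mul_wordMetric S' (wordMetric S)
  have hM : (0 : ℝ) ≤ M₂ * L := by positivity
  refine ⟨δ, M₁ + M₂ * L, M₂ * C, hδ, hyp, by linarith, by positivity, fun x y => ?_, fun x y => ?_⟩
  · have := mul_nonneg hM ((wordMetric S).dist_nonneg x y)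
    have := h₁ x y
    linarith
  · have h3 := h₂ x y
    have h4 := mul_le_mul_of_nonneg_left (hq x y).2 (zero_le_one.trans hM₂)
    have h5 := mul_nonneg (zero_le_one.trans hM₁) (d.dist_nonneg x y)
    linarith

namespace HypComparison

variable {S : SymGenSet Γ} {d : LeftInvMetric Γ} {δ M c : ℝ} (h : HypComparison S d δ M c)
include h

theorem le_gromovProd_of_le {w x y z : Γ} {B : ℝ} (h₁ : B + δ ≤ gromovProd d w x z)
    (h₂ : B + δ ≤ gromovProd d w z y) : B ≤ gromovProd d w x y := by
  have := h.hyp x y z w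
  have := le_min h₁ h₂
  linarith

/-- If the points of a path lie far from `w`, and increasingly so, then its extremities have a
large Gromov product. -/
theorem le_gromovProd_of_far {w : Γ} {T : ℕ} (hT : 0 < T) (m : ℕ) :
    ∀ (y : ℕ → Γ) (B : ℝ), (∀ i j, i ≤ j → j ≤ m → d.dist (y i) (y j) ≤ M * ((j : ℝ) - i)) →
      (∀ i ≤ m, B + M * T + ((i : ℝ) / T + 1) * δ ≤ d.dist w (y i)) →
      B ≤ gromovProd d w (y 0) (y m) := by
  have hT' : (0 : ℝ) < T := by exact_mod_cast hT
  have hδ := h.delta_nonneg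
  have hM := h.one_le
  induction m using Nat.strong_induction_on with
  | _ m ih =>
    intro y B hy hfar
    have h0 := hfar 0 (Nat.zero_le _)
    simp only [Nat.cast_zero, zero_div, zero_add, one_mul] at h0
    rcases le_or_gt m T with hm | hm
    · have h1 := hy 0 m (Nat.zero_le _) le_rfl
      have h2 := dist_sub_dist_le_gromovProd d w (y 0) (y m)
      have h3 : (m : ℝ) ≤ T := by exact_mod_cast hm
      have h4 : M * (m : ℝ) ≤ M * T := by gcongr
      push_cast at h1
      linarith
    · obtain ⟨k, rfl⟩ := Nat.exists_eq_add_of_lt hm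
      -- Dropping the first `T` points costs one use of hyperbolicity. The bound assumed at index `T
      -- + i` exceeds the one at `i` by exactly `δ`, which pays for it.
      have hstep := ih (k + 1) (by omega) (fun i => y (T + i)) (B + δ)
        (fun i j hij hj => by
          have := hy (T + i) (T + j) (by omega) (by omega)
          push_cast at this
          calc _ ≤ _ := this
            _ = _ := by ring)
        (fun i hi => by
          have := hfar (T + i) (by omega)
          have e : ((T + i : ℕ) : ℝ) / T = i / T + 1 := by
            push_cast; field_simp; ring
          rw [e] at this
          linarith)
      refine h.le_gromovProd_of_le (z := y T) ?_ (by simpa [add_assoc] using hstep)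
      have h1 := hy 0 T (Nat.zero_le _) hm.le
      have h2 := dist_sub_dist_le_gromovProd d w (y 0) (y T)
      push_cast at h1
      linarith

/-- The point `y b` is the last one within `r` of `y 0`. Beyond it the geodesic stays outside that
ball and recedes at rate at least `1 / M`, which beats the cost `δ / T` per step in
`le_gromovProd_of_far` because `M * δ ≤ T`. -/
theorem exists_le_gromovProd {T : ℕ} (hT : 0 < T) (hTδ : M * δ ≤ T) {y : ℕ → Γ} {n : ℕ}
    (hy : IsWordGeodesic S y n) {r : ℝ} (hr : 0 ≤ r) (hrn : r ≤ d.dist (y 0) (y n)) :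
    ∃ b ≤ n, d.dist (y 0) (y b) ≤ r ∧ r - M ≤ d.dist (y 0) (y b) ∧
      r - M - M * T - δ - δ / T * (M * r + c) ≤ gromovProd d (y 0) (y b) (y n) := by
  classical
  have hT' : (0 : ℝ) < T := by exact_mod_cast hT
  have hδ := h.delta_nonneg
  have hM := h.one_le
  have hc := h.nonneg
  set b := Nat.findGreatest (fun i => d.dist (y 0) (y i) ≤ r) n with hb
  have hbn : b ≤ n := Nat.findGreatest_le n
  have hbr : d.dist (y 0) (y b) ≤ r :=
    Nat.findGreatest_spec (P := fun i => d.dist (y 0) (y i) ≤ r) (Nat.zero_le n)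
      (by rwa [d.dist_self])
  have hgt : ∀ i, b < i → i ≤ n → r < d.dist (y 0) (y i) := fun i hi hin =>
    not_le.1 (Nat.findGreatest_is_greatest hi hin)
  have hjump : ∀ i j, i ≤ j → j ≤ n → d.dist (y i) (y j) ≤ M * ((j : ℝ) - i) := fun i j hij hj => by
    rw [← hy i j hij hj]; exact h.dist_le _ _
  have hfar : ∀ i, b ≤ i → i ≤ n → r - M ≤ d.dist (y 0) (y i) := by
    intro i hi hin
    rcases hi.lt_or_eq with hlt | rfl
    · linarith [hgt i hlt hin]
    · rcases hbn.lt_or_eq with hlt | heq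
      · have h1 := hgt (b + 1) (Nat.lt_succ_self _) hlt
        have h2 := hjump b (b + 1) (Nat.le_succ _) hlt
        have h3 := d.dist_triangle (y 0) (y b) (y (b + 1))
        push_cast at h2
        linarith
      · rw [heq]; linarith
  refine ⟨b, hbn, hbr, hfar b le_rfl hbn, ?_⟩
  obtain ⟨m, hm⟩ := Nat.exists_eq_add_of_le hbn
  rw [hm]
  refine h.le_gromovProd_of_far hT m (fun i => y (b + i)) _ (fun i j hij hj => ?_) (fun i hi => ?_)
  · have := hjump (b + i) (b + j) (by omega) (by omega)
    push_cast at this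
    calc _ ≤ _ := this
      _ = _ := by ring
  · have h1 := hfar (b + i) (by omega) (by omega)
    have h2 : (i : ℝ) ≤ M * d.dist (y 0) (y (b + i)) + c := by
      have := h.word_le (y 0) (y (b + i))
      rw [hy 0 (b + i) (Nat.zero_le _) (by omega)] at this
      push_cast at this
      have : (0 : ℝ) ≤ b := Nat.cast_nonneg b
      linarith
    have e : r - M - M * T - δ - δ / T * (M * r + c) + M * T + ((i : ℝ) / T + 1) * δ
        = r - M + δ / T * (i - (M * r + c)) := by field_simp; ring
    rw [e]
    have hpos : 0 ≤ δ / T := by positivity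
    -- Up to `M * r + c` steps, being outside the ball suffices; later, the quasi-isometry bound
    -- takes over.
    rcases le_total (i : ℝ) (M * r + c) with hi | hi
    · have := mul_nonpos_of_nonneg_of_nonpos hpos (sub_nonpos.2 hi)
      linarith
    · have h3 : δ / T * (i - (M * r + c)) ≤ (1 / M) * (i - (M * r + c)) := by
        apply mul_le_mul_of_nonneg_right _ (sub_nonneg.2 hi)
        rw [div_le_div_iff₀ hT' (by linarith)]
        linarith
      have h4 : (1 / M) * (i - (M * r + c)) ≤ d.dist (y 0) (y (b + i)) - r := by
        rw [div_mul_eq_mul_div, one_mul, div_le_iff₀ (by linarith)]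
        linarith
      linarith

/-- A Morse lemma. Let `r` be the product seen from `x p`. On either side there is a point at
distance about `r` from `x p` whose product with the corresponding end is nearly `r`. By
hyperbolicity these two points are close, up to a small multiple of `r`. But they lie on opposite
sides of `x p` on a word geodesic, so both are also close to `x p`, and `r` is bounded. -/
theorem exists_gromovProd_le_of_geodesic :
    ∃ K : ℝ, 0 ≤ K ∧ ∀ (x : ℕ → Γ) (n p : ℕ), IsWordGeodesic S x n → p ≤ n →
      gromovProd d (x p) (x 0) (x n) ≤ K := by
  have hδ := h.delta_nonneg
  have hM := h.one_le
  have hc := h.nonneg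
  -- Chosen so that the coefficient `2 * M ^ 3 * (δ / T)` of `r` in the final estimate is at most `1
  -- / 2`.
  obtain ⟨T, hT⟩ := exists_nat_ge (4 * M ^ 3 * δ + 1)
  have hM3 : M ≤ M ^ 3 := le_self_pow₀ hM (by norm_num)
  have hM3δ : M * δ ≤ M ^ 3 * δ := by gcongr
  have hMδ : 0 ≤ M * δ := by positivity
  have hT' : (1 : ℝ) ≤ T := by nlinarith
  have hT0 : 0 < T := by exact_mod_cast (by linarith : (0 : ℝ) < T)
  refine ⟨2 * (M + M * (2 * M * (M + M * T + 3 * δ + δ / T * c) + c)), by positivity,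
    fun x n p hx hp => ?_⟩
  set r := gromovProd d (x p) (x 0) (x n) with hr
  have hr0 : 0 ≤ r := gromovProd_nonneg _ _ _ _
  obtain ⟨m, rfl⟩ := Nat.exists_eq_add_of_le hp
  obtain ⟨b, hb, hb1, hb2, hb3⟩ := h.exists_le_gromovProd hT0 (by linarith) hx.shift hr0
    (gromovProd_le_dist_right d _ _ _)
  obtain ⟨a, ha, ha1, ha2, ha3⟩ := h.exists_le_gromovProd hT0 (by linarith)
    (hx.mono hp).reverse hr0 (by
      simp only [Nat.sub_zero, Nat.sub_self]
      exact gromovProd_le_dist_left d _ _ _)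
  simp only [Nat.sub_zero, Nat.sub_self, add_zero] at ha1 ha2 ha3 hb1 hb2 hb3
  set B := r - M - M * T - δ - δ / T * (M * r + c) with hB
  have hBr : B ≤ r := by
    have : 0 ≤ δ / T * (M * r + c) := by positivity
    have : 0 ≤ M * T := by positivity
    linarith
  have hab : B - 2 * δ ≤ gromovProd d (x p) (x (p - a)) (x (p + b)) := by
    refine h.le_gromovProd_of_le (z := x 0) (by linarith) ?_
    refine h.le_gromovProd_of_le (z := x (p + m)) (by linarith) ?_
    rw [gromovProd_comm]; linarith
  have h1 := h.word_le (x (p - a)) (x (p + b))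
  rw [hx (p - a) (p + b) (by omega) (by omega), Nat.cast_sub ha, Nat.cast_add] at h1
  have h2 : d.dist (x (p - a)) (x (p + b)) ≤ 2 * r - 2 * (B - 2 * δ) := by
    rw [gromovProd] at hab; linarith
  have h3 := h.dist_le (x p) (x (p + b))
  rw [hx p (p + b) (by omega) (by omega), Nat.cast_add] at h3
  have h4 : M * d.dist (x (p - a)) (x (p + b)) ≤ M * (2 * r - 2 * (B - 2 * δ)) := by gcongr
  have h5 : (b : ℝ) ≤ M * (2 * r - 2 * (B - 2 * δ)) + c := by
    have : (0 : ℝ) ≤ a := Nat.cast_nonneg a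
    linarith
  have h6 : M * (b : ℝ) ≤ M * (M * (2 * r - 2 * (B - 2 * δ)) + c) := by gcongr
  have h7 : 2 * M ^ 3 * (δ / T) ≤ 1 / 2 := by
    rw [mul_div_assoc', div_le_iff₀ (by linarith)]; linarith
  have h8 : 2 * M ^ 3 * (δ / T) * r ≤ 1 / 2 * r := by gcongr
  have h9 : M * (M * (2 * r - 2 * (B - 2 * δ)) + c) =
      2 * M ^ 3 * (δ / T) * r + M * (2 * M * (M + M * T + 3 * δ + δ / T * c) + c) := by
    rw [hB]; ring
  linarith

end HypComparison
end Comparison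

/-! ### Comparison of Gromov products -/

section Products

variable {Γ : Type*} [Group Γ]

namespace HypComparison

variable {S : SymGenSet Γ} {d : LeftInvMetric Γ} {δ M c : ℝ} (h : HypComparison S d δ M c)
include h

theorem dist_succ_le {x : ℕ → Γ} {n i : ℕ} (hx : IsWordGeodesic S x n) (hi : i + 1 ≤ n) :
    d.dist (x i) (x (i + 1)) ≤ M := by
  have h1 := h.dist_le (x i) (x (i + 1))
  rw [hx i (i + 1) (Nat.le_succ _) hi] at h1
  push_cast at h1
  linarith

/-- If at each point of a path one of two functions is small, then both are small somewhere, as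
soon as the first is small at the end and the second is small at the origin. -/
theorem exists_switch {x : ℕ → Γ} {n : ℕ} (hx : IsWordGeodesic S x n) (f g : ℕ → ℝ) {k : ℝ}
    (hmin : ∀ i ≤ n, min (f i) (g i) ≤ k) (hg0 : g 0 ≤ k) (hn : f n ≤ k)
    (hf : ∀ i, f i ≤ f (i + 1) + d.dist (x i) (x (i + 1))) :
    ∃ i ≤ n, f i ≤ k + M ∧ g i ≤ k + M := by
  classical
  have hM := h.one_le
  -- Take the first index where `f` is small: at the preceding one `g` is small, and `f` has grown
  -- by at most one step.
  have hex : ∃ i, f i ≤ k := ⟨n, hn⟩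
  have hle : Nat.find hex ≤ n := Nat.find_min' hex hn
  rcases Nat.eq_zero_or_eq_succ_pred (Nat.find hex) with hz | hs
  · have hf0 : f 0 ≤ k := hz ▸ Nat.find_spec hex
    exact ⟨0, Nat.zero_le _, by linarith, by linarith⟩
  · set j := (Nat.find hex).pred
    have hj : f (j + 1) ≤ k := by rw [← Nat.succ_eq_add_one, ← hs]; exact Nat.find_spec hex
    have hj' : k < f j := not_le.1 (Nat.find_min hex (by omega))
    have hgj : g j ≤ k := by
      rcases min_le_iff.1 (hmin j (by omega)) with h1 | h1
      · linarith
      · exact h1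
    have := h.dist_succ_le hx (show j + 1 ≤ n by omega)
    exact ⟨j, by omega, by linarith [hf j], by linarith⟩

/-- At the switching point `x i`, the products of `w` with both ends, seen from `x i`, are `d(w, x
i)` up to a constant; hyperbolicity bounds their minimum by the Morse constant. -/
theorem exists_dist_le_of_gromovProd_le :
    ∃ K : ℝ, 0 ≤ K ∧ ∀ (x : ℕ → Γ) (n : ℕ) (w : Γ) (k : ℝ), IsWordGeodesic S x n →
      gromovProd d w (x 0) (x n) ≤ k → ∃ i ≤ n, d.dist w (x i) ≤ k + K := by
  obtain ⟨K, hK, hgeo⟩ := h.exists_gromovProd_le_of_geodesic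
  have hδ := h.delta_nonneg
  have hM := h.one_le
  refine ⟨K + M + 2 * δ, by linarith, fun x n w k hx hk => ?_⟩
  obtain ⟨i, hi, h1, h2⟩ := h.exists_switch hx (fun i => gromovProd d w (x 0) (x i))
    (fun i => gromovProd d w (x i) (x n)) (k := k + δ)
    (fun i _ => by linarith [h.hyp (x 0) (x n) (x i) w]) (by linarith) (by linarith)
    (fun i => gromovProd_le_add_dist_right d _ _ _ _)
  refine ⟨i, hi, ?_⟩
  have h3 := hgeo x n i hx hi
  have h4 := h.hyp (x 0) (x n) w (x i)
  have h5 : min (gromovProd d (x i) (x 0) w) (gromovProd d (x i) w (x n))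
      ≥ d.dist w (x i) - (k + δ + M) := by
    refine le_min ?_ ?_
    · simp only [gromovProd, d.dist_comm (x 0) w, d.dist_comm (x i)] at h1 ⊢
      linarith
    · simp only [gromovProd, d.dist_comm (x i) w] at h2 ⊢
      linarith
  linarith

/-- Gromov products for `d` and for the word metric are comparable. -/
theorem exists_gromovProd_comparison :
    ∃ C : ℝ, ∀ w x y : Γ,
      gromovProd (wordMetric S) w x y ≤ M * gromovProd d w x y + C ∧
      gromovProd d w x y ≤ M * gromovProd (wordMetric S) w x y + C := by
  obtain ⟨K, hK, hgeo⟩ := h.exists_gromovProd_le_of_geodesic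
  obtain ⟨K₁, hK₁, hclose⟩ := h.exists_dist_le_of_gromovProd_le
  have hδ := h.delta_nonneg
  have hM := h.one_le
  have hc := h.nonneg
  set K' := K + δ + M with hK'
  set C' := M * (K' + K₁) + c with hC'
  have hC'0 : 0 ≤ C' := by positivity
  refine ⟨M * (2 * K') + c + M * (2 * C') + K, fun w x y => ?_⟩
  obtain ⟨u, n, hu, rfl, rfl⟩ := exists_isWordGeodesic S x y
  -- The point `u i` plays the role of a projection of `w` to the geodesic. In either metric, the
  -- distance from `w` to it is the Gromov product up to a constant.
  obtain ⟨i, hi, h1, h2⟩ := h.exists_switch hu (fun i => gromovProd d (u i) w (u n))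
    (fun i => gromovProd d (u i) (u 0) w) (k := K + δ)
    (fun i hi => by
      have := h.hyp (u 0) (u n) w (u i)
      have := hgeo u n i hu hi
      rw [min_comm]; linarith)
    (by have := gromovProd_le_dist_left d (u 0) (u 0) w
        rw [d.dist_self] at this; linarith)
    (by have := gromovProd_le_dist_right d (u n) w (u n)
        rw [d.dist_self] at this; linarith)
    (fun i => gromovProd_le_add_dist_base d _ _ _ _)
  have hword : ∀ v, gromovProd d (u i) w v ≤ K' → gromovProd (wordMetric S) (u i) w v ≤ C' := by
    intro v hv
    obtain ⟨p, m, hp, rfl, rfl⟩ := exists_isWordGeodesic S w v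
    obtain ⟨j, hj, hj'⟩ := hclose p m (u i) _ hp hv
    have h3 := gromovProd_le_add_dist_base (wordMetric S) (u i) (p j) (p 0) (p m)
    rw [hp.gromovProd_eq_zero hj] at h3
    have h4 := h.word_le (u i) (p j)
    have h5 : M * d.dist (u i) (p j) ≤ M * (K' + K₁) := by gcongr
    linarith
  have e1 := hword (u n) (by linarith)
  have e2 := hword (u 0) (by rw [gromovProd_comm]; linarith)
  have e3 := hu.gromovProd_eq_zero hi
  have e4 := hgeo u n i hu hi
  have p1 := gromovProd_nonneg d (u i) w (u n)
  have p2 := gromovProd_nonneg d (u i) (u 0) w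
  have q1 : gromovProd (wordMetric S) w (u 0) (u n) ≤ (wordMetric S).dist w (u i) := by
    have := gromovProd_le_add_dist_base (wordMetric S) w (u i) (u 0) (u n)
    linarith
  have q2 : gromovProd d w (u 0) (u n) ≤ d.dist w (u i) + K := by
    have := gromovProd_le_add_dist_base d w (u i) (u 0) (u n)
    linarith
  have q3 : d.dist w (u i) ≤ gromovProd d w (u 0) (u n) + 2 * K' := by
    have := d.dist_triangle (u 0) (u i) (u n)
    have := gromovProd_nonneg d (u i) (u 0) (u n)
    simp only [gromovProd, d.dist_comm (u i) w, d.dist_comm (u 0) w] at *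
    linarith
  have q4 : (wordMetric S).dist w (u i) ≤ gromovProd (wordMetric S) w (u 0) (u n) + 2 * C' := by
    simp only [gromovProd, (wordMetric S).dist_comm (u i) w] at *
    linarith
  have r1 := h.word_le w (u i)
  have r2 := h.dist_le w (u i)
  have r3 : M * d.dist w (u i) ≤ M * (gromovProd d w (u 0) (u n) + 2 * K') := by gcongr
  have r4 : M * (wordMetric S).dist w (u i)
      ≤ M * (gromovProd (wordMetric S) w (u 0) (u n) + 2 * C') := by gcongr
  have s1 : 0 ≤ M * (2 * K') := by positivity
  have s2 : 0 ≤ M * (2 * C') := by positivity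
  constructor <;> linarith

end HypComparison

/-! ### Sequences converging to the same boundary point -/

theorem tendToSamePoint_iff {d : LeftInvMetric Γ} {x y : ℕ → Γ} :
    TendToSamePoint d x y ↔
      ∀ B : ℝ, ∃ N : ℕ, ∀ n m, N ≤ n → N ≤ m → B ≤ gromovProd d 1 (x n) (y m) := by
  simp only [TendToSamePoint, tendsto_atTop, eventually_atTop]
  refine forall_congr' fun B => ⟨?_, ?_⟩
  · rintro ⟨⟨a, b⟩, hab⟩
    exact ⟨max a b, fun n m hn hm => hab (n, m)
      ⟨(le_max_left _ _).trans hn, (le_max_right _ _).trans hm⟩⟩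
  · rintro ⟨N, hN⟩
    exact ⟨(N, N), fun p hp => hN p.1 p.2 hp.1 hp.2⟩

theorem TendToSamePoint.exists_forall_le {d : LeftInvMetric Γ} {x y : ℕ → Γ}
    (hxy : TendToSamePoint d x y) (w : Γ) (B : ℝ) :
    ∃ N : ℕ, ∀ n m, N ≤ n → N ≤ m → B ≤ gromovProd d w (x n) (y m) := by
  obtain ⟨N, hN⟩ := tendToSamePoint_iff.1 hxy (B + d.dist 1 w)
  refine ⟨N, fun n m hn hm => ?_⟩
  have := hN n m hn hm
  have := gromovProd_le_add_dist_base d 1 w (x n) (y m)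
  linarith

theorem TendToSamePoint.symm {d : LeftInvMetric Γ} {x y : ℕ → Γ}
    (hxy : TendToSamePoint d x y) : TendToSamePoint d y x := by
  rw [tendToSamePoint_iff] at hxy ⊢
  intro B
  obtain ⟨N, hN⟩ := hxy B
  exact ⟨N, fun n m hn hm => gromovProd_comm d 1 _ _ ▸ hN m n hm hn⟩

theorem TendToSamePoint.comp {d : LeftInvMetric Γ} {x y : ℕ → Γ}
    (hxy : TendToSamePoint d x y) {a b : ℕ → ℕ} (ha : ∀ n, n ≤ a n) (hb : ∀ n, n ≤ b n) :
    TendToSamePoint d (fun n => x (a n)) (fun n => y (b n)) := by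
  rw [tendToSamePoint_iff] at hxy ⊢
  intro B
  obtain ⟨N, hN⟩ := hxy B
  exact ⟨N, fun n m hn hm => hN _ _ (hn.trans (ha n)) (hm.trans (hb m))⟩

namespace HypComparison

variable {S : SymGenSet Γ} {d : LeftInvMetric Γ} {δ M c : ℝ} (h : HypComparison S d δ M c)
include h

theorem tendToSamePoint_word_iff {x y : ℕ → Γ} :
    TendToSamePoint (wordMetric S) x y ↔ TendToSamePoint d x y := by
  obtain ⟨C, hC⟩ := h.exists_gromovProd_comparison
  have hM : 0 < M := zero_lt_one.trans_le h.one_le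
  have aux : ∀ d₁ d₂ : LeftInvMetric Γ,
      (∀ w x y : Γ, gromovProd d₁ w x y ≤ M * gromovProd d₂ w x y + C) →
      TendToSamePoint d₁ x y → TendToSamePoint d₂ x y := by
    intro d₁ d₂ h12 h1
    rw [tendToSamePoint_iff] at h1 ⊢
    intro B
    obtain ⟨N, hN⟩ := h1 (M * B + C)
    refine ⟨N, fun n m hn hm => le_of_mul_le_mul_left ?_ hM⟩
    linarith [hN n m hn hm, h12 1 (x n) (y m)]
  exact ⟨aux _ _ fun w x y => (hC w x y).1, aux _ _ fun w x y => (hC w x y).2⟩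

theorem tendToSamePoint_trans {x y z : ℕ → Γ} (hxy : TendToSamePoint d x y)
    (hyz : TendToSamePoint d y z) : TendToSamePoint d x z := by
  rw [tendToSamePoint_iff] at hxy hyz ⊢
  intro B
  obtain ⟨N, hN⟩ := hxy (B + δ)
  obtain ⟨N', hN'⟩ := hyz (B + δ)
  refine ⟨max N N', fun n m hn hm => ?_⟩
  simp only [max_le_iff] at hn hm
  exact h.le_gromovProd_of_le (hN n _ hn.1 (le_max_left _ _)) (hN' _ m (le_max_right _ _) hm.2)

/-- The boundary is built from the word metric, but transitivity of the relation is drawn from the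
hyperbolicity of `d`. -/
theorem boundary_mk_eq_iff {x y : DivergentSeq (wordMetric S)} :
    Boundary.mk _ x = Boundary.mk _ y ↔ TendToSamePoint d x.1 y.1 := by
  refine ⟨fun hxy => ?_, fun hxy => Quot.sound (h.tendToSamePoint_word_iff.2 hxy)⟩
  induction Quot.eqvGen_exact hxy with
  | rel x y hr => exact h.tendToSamePoint_word_iff.1 hr
  | refl x => exact h.tendToSamePoint_word_iff.1 x.2
  | symm x y hr ih => exact (ih (Quot.eqvGen_sound hr)).symm
  | trans x y z h1 h2 ih1 ih2 =>
    exact h.tendToSamePoint_trans (ih1 (Quot.eqvGen_sound h1)) (ih2 (Quot.eqvGen_sound h2))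

theorem smul_boundary_mk_eq_iff (g : Γ) {x y : DivergentSeq (wordMetric S)} :
    g • Boundary.mk _ x = Boundary.mk _ y ↔ TendToSamePoint d (fun n => g * x.1 n) y.1 :=
  h.boundary_mk_eq_iff (x := ⟨fun n => g * x.1 n, x.2.mul_left g⟩)

end HypComparison
end Products

/-! ### Busemann functions and the flow space -/

section Busemann

variable {Γ : Type*} [Group Γ]

theorem IsStronglyHyperbolic.exists_busemann_close {d : LeftInvMetric Γ}
    (hs : IsStronglyHyperbolic d) {z z' : ℕ → Γ} (hz : TendToSamePoint d z z') (x : Γ) {ε : ℝ}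
    (hε : 0 < ε) :
    ∃ N : ℕ, ∀ n m, N ≤ n → N ≤ m →
      |(d.dist x (z n) - d.dist 1 (z n)) - (d.dist x (z' m) - d.dist 1 (z' m))| < ε := by
  obtain ⟨-, L, s, R₀, hL, hs, hR₀, hstrong⟩ := hs
  have hlim : Tendsto (fun R : ℝ => L * Real.exp (-s * R)) atTop (𝓝 0) := by
    rw [← mul_zero L]
    refine Tendsto.const_mul L (Real.tendsto_exp_atBot.comp ?_)
    exact tendsto_id.const_mul_atTop_of_neg (neg_lt_zero.2 hs)
  obtain ⟨R, hR, hRR₀⟩ := ((hlim.eventually (gt_mem_nhds hε)).and (eventually_ge_atTop R₀)).exists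
  -- Strong hyperbolicity is applied to `x, 1, z n, z' m`. Its hypothesis involves twice the product
  -- based at `1`, less an error of at most `2 * d.dist 1 x`.
  obtain ⟨N, hN⟩ := tendToSamePoint_iff.1 hz (R / 2 + d.dist 1 x)
  refine ⟨N, fun n m hn hm => ?_⟩
  have h1 := hN n m hn hm
  have h2 := d.dist_triangle 1 x (z n)
  rw [gromovProd] at h1
  refine lt_of_le_of_lt ?_ hR
  have h3 := hstrong x 1 (z n) (z' m) R hRR₀ (by rw [d.dist_comm x 1]; linarith)
  refine le_trans (le_of_eq (congrArg _ ?_)) h3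
  ring

variable {S : SymGenSet Γ} {d : LeftInvMetric Γ} {δ M c : ℝ} (h : HypComparison S d δ M c)
  (hs : IsStronglyHyperbolic d)
include h hs

namespace HypComparison

/-- The differences form a Cauchy sequence, and all sequences in the class share the limit, so the
supremum defining `busemann` is over a singleton. -/
theorem tendsto_busemann (x : Γ) (z : DivergentSeq (wordMetric S)) :
    Tendsto (fun n => d.dist x (z.1 n) - d.dist 1 (z.1 n)) atTop
      (𝓝 (busemann S d x (Boundary.mk _ z))) := by
  have hz := h.tendToSamePoint_word_iff.1 z.2
  obtain ⟨l, hl⟩ : ∃ l, Tendsto (fun n => d.dist x (z.1 n) - d.dist 1 (z.1 n)) atTop (𝓝 l) := by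
    refine cauchySeq_tendsto_of_complete (Metric.cauchySeq_iff.2 fun ε hε => ?_)
    obtain ⟨N, hN⟩ := hs.exists_busemann_close hz x hε
    exact ⟨N, fun m hm n hn => hN m n hm hn⟩
  have hset : {r : ℝ | ∃ z' : DivergentSeq (wordMetric S), Boundary.mk _ z' = Boundary.mk _ z ∧
      r = limsup (fun n => d.dist x (z'.1 n) - d.dist 1 (z'.1 n)) atTop} = {l} := by
    refine Set.eq_singleton_iff_unique_mem.2 ⟨⟨z, rfl, hl.limsup_eq.symm⟩, ?_⟩
    rintro r ⟨z', hz', rfl⟩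
    refine Tendsto.limsup_eq ?_
    rw [Metric.tendsto_atTop]
    intro ε hε
    obtain ⟨N, hN⟩ := hs.exists_busemann_close (h.boundary_mk_eq_iff.1 hz') x (half_pos hε)
    obtain ⟨N', hN'⟩ := Metric.tendsto_atTop.1 hl (ε / 2) (half_pos hε)
    refine ⟨N, fun n hn => ?_⟩
    have h1 := hN n (max N N') hn (le_max_left _ _)
    have h2 := hN' (max N N') (le_max_right _ _)
    rw [Real.dist_eq, abs_lt] at *
    constructor <;> linarith
  rw [busemann, hset, csSup_singleton]
  exact hl

theorem tendsto_cocycle (x : Γ) (z y : DivergentSeq (wordMetric S)) :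
    Tendsto (fun n => (1 / 2) * ((d.dist x⁻¹ (z.1 n) - d.dist 1 (z.1 n)) -
      (d.dist x⁻¹ (y.1 n) - d.dist 1 (y.1 n)))) atTop
      (𝓝 (cocycle S d x (Boundary.mk _ z, Boundary.mk _ y))) :=
  ((h.tendsto_busemann hs x⁻¹ z).sub (h.tendsto_busemann hs x⁻¹ y)).const_mul _

theorem busemann_mul_smul (g x : Γ) (ξ : Boundary (wordMetric S)) :
    busemann S d (g * x) (g • ξ) = busemann S d x ξ + busemann S d g (g • ξ) := by
  induction ξ using Quot.ind with
  | mk z =>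
    let gz : DivergentSeq (wordMetric S) := ⟨fun n => g * z.1 n, z.2.mul_left g⟩
    have h1 := h.tendsto_busemann hs (g * x) gz
    have h2 := (h.tendsto_busemann hs x z).add (h.tendsto_busemann hs g gz)
    refine tendsto_nhds_unique h1 (h2.congr fun n => ?_)
    have e := d.dist_mul_left g 1 (z.1 n)
    rw [mul_one] at e
    simp only [gz, d.dist_mul_left, e]
    ring

theorem cocycle_mul (x y : Γ) (p : Boundary (wordMetric S) × Boundary (wordMetric S)) :
    cocycle S d (x * y) p = cocycle S d x (y • p.1, y • p.2) + cocycle S d y p := by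
  have h1 := h.busemann_mul_smul hs y⁻¹ x⁻¹ (y • p.1)
  have h2 := h.busemann_mul_smul hs y⁻¹ x⁻¹ (y • p.2)
  rw [inv_smul_smul] at h1 h2
  simp only [cocycle, mul_inv_rev, h1, h2]
  ring

theorem cocycle_one (p : Boundary (wordMetric S) × Boundary (wordMetric S)) :
    cocycle S d 1 p = 0 := by
  have := h.cocycle_mul hs 1 1 p
  rw [one_mul, one_smul, one_smul] at this
  linarith

theorem lineAct_one (q : LineSpace S) : lineAct S d 1 q = q := by
  refine Prod.ext (Subtype.ext (Prod.ext (one_smul _ _) (one_smul _ _))) ?_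
  simp [lineAct, h.cocycle_one hs]

theorem lineAct_mul (x y : Γ) (q : LineSpace S) :
    lineAct S d (x * y) q = lineAct S d x (lineAct S d y q) := by
  refine Prod.ext (Subtype.ext (Prod.ext (mul_smul _ _ _) (mul_smul _ _ _))) ?_
  simp only [lineAct, h.cocycle_mul hs]
  ring

/-- By the cocycle identity `lineAct` is a group action, so the relation under `Quot` is already an
equivalence relation. -/
theorem flowSpace_mk_eq_iff {q q' : LineSpace S} :
    FlowSpace.mk S d q = FlowSpace.mk S d q' ↔ ∃ g : Γ, q' = lineAct S d g q := by
  refine ⟨fun hq => ?_, fun hq => Quot.sound hq⟩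
  induction Quot.eqvGen_exact hq with
  | rel x y hr => exact hr
  | refl x => exact ⟨1, (h.lineAct_one hs x).symm⟩
  | symm x y hr ih =>
    obtain ⟨g, rfl⟩ := ih (Quot.eqvGen_sound hr)
    exact ⟨g⁻¹, by rw [← h.lineAct_mul hs, inv_mul_cancel, h.lineAct_one hs]⟩
  | trans x y z h1 h2 ih1 ih2 =>
    obtain ⟨g, rfl⟩ := ih1 (Quot.eqvGen_sound h1)
    obtain ⟨g', rfl⟩ := ih2 (Quot.eqvGen_sound h2)
    exact ⟨g' * g, h.lineAct_mul hs _ _ _ ▸ rfl⟩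

end HypComparison
end Busemann

/-! ### Rays of the coding -/

section Rays

variable {Γ : Type*} [Group Γ] {S : SymGenSet Γ} {V E : Type*} (A : StronglyMarkov S V E)

theorem shift_iterate_apply (k : ℕ) (ω : BiPath A) (i : ℤ) :
    ((shift A)^[k] ω).1 i = ω.1 (i + k) := by
  induction k generalizing i with
  | zero => simp
  | succ k ih =>
    rw [Function.iterate_succ_apply']
    change ((shift A)^[k] ω).1 (i + 1) = _
    rw [ih]
    exact congrArg ω.1 (by push_cast; ring)

theorem shift_surjective : Function.Surjective (shift A) := by
  intro ω
  refine ⟨⟨fun i => ω.1 (i - 1), fun i => ?_⟩, Subtype.ext (funext fun i => ?_)⟩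
  · have := ω.2 (i - 1)
    rw [sub_add_cancel] at this
    exact this.trans (congrArg (fun j => A.src (ω.1 j)) (by ring))
  · simp [shift]

theorem isPath_segment (ω : BiPath A) (z : ℤ) (n : ℕ) : A.IsPath (segment A ω z n) := by
  unfold Automaton.IsPath segment
  rw [List.isChain_iff_getElem]
  intro i hi
  simp only [List.getElem_map, List.getElem_range]
  rw [ω.2]
  push_cast
  rw [add_assoc]

theorem terminus_append (l l' : List E) :
    A.terminus (l ++ l') = A.terminus l * A.terminus l' := by
  simp [Automaton.terminus]

theorem segment_add (ω : BiPath A) (z : ℤ) (m n : ℕ) :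
    segment A ω z (m + n) = segment A ω z m ++ segment A ω (z + m) n := by
  simp [segment, List.range_add, Function.comp_def, add_assoc]

theorem isWordGeodesic_segment (ω : BiPath A) (z : ℤ) (n : ℕ) :
    IsWordGeodesic S (fun i => A.terminus (segment A ω z i)) n := by
  intro i j hij hj
  obtain ⟨k, rfl⟩ := Nat.exists_eq_add_of_le hij
  simp [segment_add, terminus_append, wordMetric, segment_length]

theorem isWordGeodesic_fwd (ω : BiPath A) (n : ℕ) : IsWordGeodesic S (fwd A ω) n := by
  intro i j hij hj
  obtain ⟨k, rfl⟩ := Nat.exists_eq_add_of_le hij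
  rw [fwd_ray]; push_cast; ring

theorem isWordGeodesic_bwd (ω : BiPath A) (n : ℕ) : IsWordGeodesic S (bwd A ω) n := by
  intro i j hij hj
  obtain ⟨k, rfl⟩ := Nat.exists_eq_add_of_le hij
  rw [bwd_ray]; push_cast; ring

theorem bwd_mul_terminus (ω : BiPath A) (m : ℕ) :
    bwd A ω m * A.terminus (segment A ω (-m) m) = 1 := by
  have := bwd_add A ω 0 m
  rw [zero_add] at this
  simp [this, bwd]

/-- The two rays are the halves of one translated path, hence of one word geodesic through the
identity. -/
theorem bwd_mul_terminus_add (ω : BiPath A) (m n : ℕ) :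
    bwd A ω m * A.terminus (segment A ω (-m) (m + n)) = fwd A ω n := by
  have := fwd_add A ω 0 n
  rw [zero_add] at this
  rw [segment_add, terminus_append, ← mul_assoc, bwd_mul_terminus, this]
  simp [fwd]

theorem fwd_shift (ω : BiPath A) (n : ℕ) :
    fwd A (shift A ω) n = (A.label (ω.1 0))⁻¹ * fwd A ω (n + 1) := by
  induction n with
  | zero => simp [fwd]
  | succ n ih =>
    rw [fwd, ih, mul_assoc]
    simp [shift, fwd]

theorem bwd_shift (ω : BiPath A) (n : ℕ) :
    bwd A (shift A ω) (n + 1) = (A.label (ω.1 0))⁻¹ * bwd A ω n := by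
  induction n with
  | zero => simp [bwd, shift]
  | succ n ih =>
    rw [bwd, ih, mul_assoc]
    simp [shift, bwd]

theorem xiPlus_shift (ω : BiPath A) :
    xiPlus A (shift A ω) = (A.label (ω.1 0))⁻¹ • xiPlus A ω := by
  refine Quot.sound ?_
  have := ((tendToSamePoint_of_ray _ rfl (fwd_ray A ω)).comp (a := fun n => n + 1) (b := id)
    (fun n => n.le_succ) (fun n => le_rfl)).mul_left (A.label (ω.1 0))⁻¹
  simpa only [← fwd_shift, id] using this

theorem xiMinus_shift (ω : BiPath A) :
    xiMinus A (shift A ω) = (A.label (ω.1 0))⁻¹ • xiMinus A ω := by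
  refine Quot.sound ?_
  have := ((tendToSamePoint_of_ray _ rfl (bwd_ray A (shift A ω))).comp (a := id)
    (b := fun n => n + 1) (fun n => le_rfl) (fun n => n.le_succ))
  simpa only [bwd_shift, id] using this

theorem wStar_shift_iterate (k : ℕ) (ω : BiPath A) :
    wStar A ((shift A)^[k] ω) =
      ((fwd A ω k)⁻¹ • (wStar A ω).1, (fwd A ω k)⁻¹ • (wStar A ω).2) := by
  induction k with
  | zero => simp [fwd]
  | succ k ih =>
    have h0 := shift_iterate_apply A k ω 0
    rw [zero_add] at h0
    simp only [wStar, Prod.mk.injEq] at ih ⊢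
    rw [Function.iterate_succ_apply', xiMinus_shift, xiPlus_shift, ih.1, ih.2, h0, smul_smul,
      smul_smul, fwd, mul_inv_rev]
    exact ⟨rfl, rfl⟩

theorem le_boundaryProd {x y : DivergentSeq (wordMetric S)} {p : Γ} {n : ℕ} {R : ℝ}
    (hx : ∀ k, (wordMetric S).dist 1 (x.1 (n + k)) = (n : ℝ) + (wordMetric S).dist p (x.1 (n + k)))
    (hy : ∀ k, (wordMetric S).dist 1 (y.1 (n + k)) = (n : ℝ) + (wordMetric S).dist p (y.1 (n + k)))
    (hR : R < n) : (R : EReal) < boundaryProd (wordMetric S) (Boundary.mk _ x) (Boundary.mk _ y) := by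
  refine lt_of_lt_of_le (EReal.coe_lt_coe_iff.2 hR) ?_
  refine le_trans ?_ (le_sSup ⟨x, y, rfl, rfl, rfl⟩)
  refine le_liminf_of_le (by isBoundedDefault) ?_
  filter_upwards [eventually_ge_atTop n] with m hm
  obtain ⟨k, rfl⟩ := Nat.exists_eq_add_of_le hm
  refine EReal.coe_le_coe_iff.2 ?_
  have := (wordMetric S).dist_triangle (x.1 (n + k)) p (y.1 (n + k))
  rw [(wordMetric S).dist_comm _ p] at this
  rw [gromovProd, hx, hy]
  linarith

theorem eventually_eq_on (ω : BiPath A) (s : Finset ℤ) :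
    ∀ᶠ ω' in 𝓝 ω, ∀ i ∈ s, ω'.1 i = ω.1 i := by
  let _ : TopologicalSpace E := ⊥
  have : DiscreteTopology E := ⟨rfl⟩
  rw [Filter.eventually_all_finset]
  intro i _
  have hc : Continuous (fun ω : BiPath A => ω.1 i) := (continuous_apply i).comp continuous_induced_dom
  exact hc.continuousAt.eventually (eventually_of_mem ((isOpen_discrete {ω.1 i}).mem_nhds rfl)
    (fun _ h => h))

theorem fwd_congr {ω ω' : BiPath A} {n : ℕ} (h : ∀ i : ℤ, -n ≤ i → i < n → ω'.1 i = ω.1 i) :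
    fwd A ω' n = fwd A ω n := by
  have key : ∀ k ≤ n, fwd A ω' k = fwd A ω k := by
    intro k
    induction k with
    | zero => intro _; rfl
    | succ k ih => intro hk; rw [fwd, fwd, ih (by omega), h k (by omega) (by omega)]
  exact key n le_rfl

theorem bwd_congr {ω ω' : BiPath A} {n : ℕ} (h : ∀ i : ℤ, -n ≤ i → i < n → ω'.1 i = ω.1 i) :
    bwd A ω' n = bwd A ω n := by
  have key : ∀ k ≤ n, bwd A ω' k = bwd A ω k := by
    intro k
    induction k with
    | zero => intro _; rfl
    | succ k ih => intro hk; rw [bwd, bwd, ih (by omega), h (-(k + 1)) (by omega) (by omega)]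
  exact key n le_rfl

theorem dist_one_ray {x : ℕ → Γ} (h0 : x 0 = 1)
    (h : ∀ m n : ℕ, (wordMetric S).dist (x m) (x (m + n)) = n) (n k : ℕ) :
    (wordMetric S).dist 1 (x (n + k)) = (n : ℝ) + (wordMetric S).dist (x n) (x (n + k)) := by
  have := h 0 (n + k)
  rw [zero_add, h0] at this
  rw [this, h]; push_cast; ring

/-- Paths that agree on `[-n, n)` have rays through a common point at distance `n` from the
identity, so their limits have boundary product at least `n`. The symmetric window lets one
statement serve both rays. -/
theorem continuous_of_ray (f : BiPath A → Boundary (wordMetric S)) (r : BiPath A → ℕ → Γ)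
    (h0 : ∀ ω, r ω 0 = 1)
    (h : ∀ ω (m n : ℕ), (wordMetric S).dist (r ω m) (r ω (m + n)) = n)
    (hcongr : ∀ ω ω' (n : ℕ), (∀ i : ℤ, -n ≤ i → i < n → ω'.1 i = ω.1 i) → r ω' n = r ω n)
    (hf : ∀ ω, f ω = Boundary.mk _ ⟨r ω, tendToSamePoint_of_ray _ (h0 ω) (h ω)⟩) :
    Continuous f := by
  rw [continuous_def]
  intro U hU
  rw [isOpen_iff_mem_nhds]
  intro ω hω
  obtain ⟨R, hR⟩ := hU (f ω) hω
  obtain ⟨n, hn⟩ := exists_nat_gt R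
  filter_upwards [eventually_eq_on A ω (Finset.Ico (-n) n)] with ω' hω'
  refine hR _ ?_
  rw [hf, hf]
  have hp := hcongr ω ω' n (fun i h1 h2 => hω' i (Finset.mem_Ico.2 ⟨h1, h2⟩))
  refine le_boundaryProd (p := r ω n) (dist_one_ray (h0 ω) (h ω) n) ?_ hn
  rw [← hp]
  exact dist_one_ray (h0 ω') (h ω') n

theorem continuous_wStar : Continuous (wStar A) :=
  (continuous_of_ray A _ _ (fun _ => rfl) (bwd_ray A) (fun _ _ _ => bwd_congr A)
    (fun _ => rfl)).prodMk
  (continuous_of_ray A _ _ (fun _ => rfl) (fwd_ray A) (fun _ _ _ => fwd_congr A) (fun _ => rfl))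

end Rays

/-! ### The roof function and the coding map -/

section Roof

variable {Γ : Type*} [Group Γ] {S : SymGenSet Γ} {V E : Type*} (A : StronglyMarkov S V E)
  {d : LeftInvMetric Γ} {δ M c : ℝ}

namespace HypComparison

theorem exists_gromovProd_bwd_fwd_le (h : HypComparison S d δ M c) :
    ∃ K : ℝ, 0 ≤ K ∧ ∀ (ω : BiPath A) (m n : ℕ), gromovProd d 1 (bwd A ω m) (fwd A ω n) ≤ K := by
  obtain ⟨K, hK, hgeo⟩ := h.exists_gromovProd_le_of_geodesic
  refine ⟨K, hK, fun ω m n => ?_⟩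
  have := hgeo _ (m + n) m ((isWordGeodesic_segment A ω (-m) (m + n)).mul_left (bwd A ω m))
    (Nat.le_add_right _ _)
  simp only [bwd_mul_terminus, bwd_mul_terminus_add] at this
  simpa [segment, Automaton.terminus] using this

theorem wStar_ne (h : HypComparison S d δ M c) (ω : BiPath A) :
    (wStar A ω).1 ≠ (wStar A ω).2 := by
  intro heq
  obtain ⟨K, -, hK⟩ := h.exists_gromovProd_bwd_fwd_le A
  obtain ⟨N, hN⟩ := tendToSamePoint_iff.1 (h.boundary_mk_eq_iff.1 heq) (K + 1)
  have := hN N N le_rfl le_rfl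
  have := hK ω N N
  linarith

theorem roof_eq_cocycle (h : HypComparison S d δ M c) (hs : IsStronglyHyperbolic d) (N : ℕ)
    (ω : BiPath A) : roof A d N ω = cocycle S d (fwd A ω N)⁻¹ (wStar A ω) := by
  induction N with
  | zero => simp [roof, fwd, h.cocycle_one hs]
  | succ N ih =>
    have h0 := shift_iterate_apply A N ω 0
    rw [zero_add] at h0
    rw [roof, Finset.sum_range_succ, ← roof, ih, fwd, mul_inv_rev, h.cocycle_mul hs, alphaTilde,
      wStar_shift_iterate, h0]
    ring

/-- The upper bound is the triangle inequality. The lower one uses the Morse lemma twice: at `fwd A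
ω N` on the forward ray, and at the identity on the bilateral geodesic. -/
theorem exists_roof_bounds (h : HypComparison S d δ M c) (hs : IsStronglyHyperbolic d) :
    ∃ K : ℝ, ∀ (N : ℕ) (ω : BiPath A),
      d.dist 1 (fwd A ω N) - K ≤ roof A d N ω ∧ roof A d N ω ≤ d.dist 1 (fwd A ω N) := by
  obtain ⟨K, hK, hgeo⟩ := h.exists_gromovProd_le_of_geodesic
  obtain ⟨K', hK', hbf⟩ := h.exists_gromovProd_bwd_fwd_le A
  refine ⟨K + K', fun N ω => ?_⟩
  have hlim := h.tendsto_cocycle hs (fwd A ω N)⁻¹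
    ⟨bwd A ω, tendToSamePoint_of_ray _ rfl (bwd_ray A ω)⟩
    ⟨fwd A ω, tendToSamePoint_of_ray _ rfl (fwd_ray A ω)⟩
  rw [h.roof_eq_cocycle A hs]
  constructor
  · refine ge_of_tendsto hlim ?_
    filter_upwards [eventually_ge_atTop N] with n hn
    have h1 := hgeo _ n N (isWordGeodesic_fwd A ω n) hn
    have h2 := hbf ω n N
    simp only [gromovProd, inv_inv, fwd, d.dist_comm (fwd A ω N) 1,
      d.dist_comm (bwd A ω n) (fwd A ω N)] at h1 h2 ⊢
    linarith
  · refine le_of_tendsto hlim (Eventually.of_forall fun n => ?_)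
    have h1 := d.dist_triangle (fwd A ω N) 1 (bwd A ω n)
    have h2 := d.dist_triangle 1 (fwd A ω N) (fwd A ω n)
    rw [d.dist_comm _ 1] at h1
    simp only [inv_inv]
    linarith

theorem exists_isRoofTime (h : HypComparison S d δ M c) (hs : IsStronglyHyperbolic d) :
    ∃ N : ℕ, IsRoofTime A d N := by
  obtain ⟨K, hK⟩ := h.exists_roof_bounds A hs
  have hM := h.one_le
  -- After this many steps the forward ray is at `d`-distance at least `K + 1` from the identity, so
  -- the roof is at least `1`.
  obtain ⟨N, hN⟩ := exists_nat_ge (M * (K + 1) + c)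
  have hdist : ∀ (k : ℕ) (ω : BiPath A), (wordMetric S).dist 1 (fwd A ω k) = k := fun k ω => by
    have := fwd_ray A ω 0 k
    rwa [zero_add] at this
  refine ⟨N + 1, Nat.le_add_left _ _, 1, M * (N + 1), one_pos, by positivity, fun ω => ⟨?_, ?_⟩⟩
  · have h1 := h.word_le 1 (fwd A ω (N + 1))
    rw [hdist] at h1
    have h2 : K + 1 ≤ d.dist 1 (fwd A ω (N + 1)) := by
      refine le_of_mul_le_mul_left ?_ (zero_lt_one.trans_le hM)
      push_cast at h1
      linarith
    linarith [(hK (N + 1) ω).1]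
  · have h1 := h.dist_le 1 (fwd A ω (N + 1))
    rw [hdist] at h1
    push_cast at h1
    linarith [(hK (N + 1) ω).2]

variable (h : HypComparison S d δ M c) (hs : IsStronglyHyperbolic d)

/-- The map `[ω, t] ↦ [w_*(ω), t]`. -/
noncomputable def codingMap (N : ℕ) : Suspension A d N → FlowSpace S d :=
  Quot.lift (fun p => FlowSpace.mk S d (⟨wStar A p.1, h.wStar_ne A p.1⟩, p.2)) (by
    rintro _ _ ⟨ω, t, rfl, rfl⟩
    refine (h.flowSpace_mk_eq_iff hs).2 ⟨(fwd A ω N)⁻¹, Prod.ext (Subtype.ext ?_) ?_⟩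
    · exact wStar_shift_iterate A N ω
    · simp only [lineAct, h.roof_eq_cocycle A hs]
      ring)

theorem continuous_codingMap (N : ℕ) : Continuous (h.codingMap A hs N) := by
  refine continuous_quot_lift _ (continuous_quot_mk.comp ?_)
  exact (((continuous_wStar A).comp continuous_fst).subtype_mk _).prodMk continuous_snd

theorem codingMap_flow (N : ℕ) (t : ℝ) (p : Suspension A d N) :
    h.codingMap A hs N (Suspension.flow A d N t p)
      = FlowSpace.flow S d t (h.codingMap A hs N p) := by
  induction p using Quot.ind with
  | mk p => rfl

end HypComparison
end Roof

/-! ### Surjectivity of the coding -/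

section Surjectivity

variable {Γ : Type*} [Group Γ]

theorem finite_wordBall (S : SymGenSet Γ) (R : ℝ) :
    {g : Γ | (wordMetric S).dist 1 g ≤ R}.Finite := by
  refine ((List.finite_length_le S.carrier ⌊R⌋₊).image
    (fun l => (l.map Subtype.val).prod)).subset fun g hg => ?_
  obtain ⟨l, hl, hp, hlen⟩ := wordLength_spec S g
  have hg' : (wordLength S g : ℝ) ≤ R := by simpa [wordMetric] using hg
  refine ⟨l.attach.map fun s => ⟨s.1, hl s.1 s.2⟩, ?_, ?_⟩
  · simpa [hlen] using Nat.le_floor hg'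
  · simp [List.map_map, Function.comp_def, hp]

/-- Since `y` is divergent, it suffices to compare `x n` with some arbitrarily late terms of `y`.
Limits along an ultrafilter provide no more than that. -/
theorem HypComparison.tendToSamePoint_of_frequently {S : SymGenSet Γ} {d : LeftInvMetric Γ}
    {δ M c : ℝ} (h : HypComparison S d δ M c) {x y : ℕ → Γ} (hy : TendToSamePoint d y y)
    (hxy : ∀ B : ℝ, ∃ N : ℕ, ∀ n, N ≤ n → ∀ k₀ : ℕ, ∃ k, k₀ ≤ k ∧
      B ≤ gromovProd (wordMetric S) 1 (x n) (y k)) : TendToSamePoint d x y := by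
  obtain ⟨C, hC⟩ := h.exists_gromovProd_comparison
  have hM : 0 < M := zero_lt_one.trans_le h.one_le
  rw [tendToSamePoint_iff] at hy ⊢
  intro B
  obtain ⟨N, hN⟩ := hxy (M * (B + δ) + C)
  obtain ⟨N', hN'⟩ := hy (B + δ)
  refine ⟨max N N', fun n m hn hm => ?_⟩
  simp only [max_le_iff] at hn hm
  obtain ⟨k, hk, hB⟩ := hN n hn.1 N'
  refine h.le_gromovProd_of_le (z := y k) (le_of_mul_le_mul_left ?_ hM) (hN' k m hk hm.2)
  linarith [(hC 1 (x n) (y k)).1]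

theorem IsWordGeodesic.gromovProd_end {S : SymGenSet Γ} {v : ℕ → Γ} {n i j : ℕ}
    (hv : IsWordGeodesic S v n) (hij : i ≤ j) (hj : j ≤ n) :
    gromovProd (wordMetric S) (v i) (v j) (v n) = (j : ℝ) - i := by
  rw [gromovProd, hv i j hij hj, hv i n (hij.trans hj) le_rfl, hv j n hj le_rfl]
  ring

theorem IsWordGeodesic.gromovProd_origin {S : SymGenSet Γ} {v : ℕ → Γ} {n i j : ℕ}
    (hv : IsWordGeodesic S v n) (hji : j ≤ i) (hi : i ≤ n) :
    gromovProd (wordMetric S) (v i) (v j) (v 0) = (i : ℝ) - j := by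
  rw [gromovProd, (wordMetric S).dist_comm (v i), (wordMetric S).dist_comm (v i),
    (wordMetric S).dist_comm (v j) (v 0), hv j i hji hi, hv 0 i (Nat.zero_le _) hi,
    hv 0 j (Nat.zero_le _) (hji.trans hi)]
  push_cast; ring

theorem tendsto_dist_one {d : LeftInvMetric Γ} {x : ℕ → Γ} (hx : TendToSamePoint d x x) :
    Tendsto (fun n => d.dist 1 (x n)) atTop atTop := by
  refine tendsto_atTop.2 fun B => ?_
  obtain ⟨N, hN⟩ := tendToSamePoint_iff.1 hx B
  filter_upwards [eventually_ge_atTop N] with n hn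
  simpa [gromovProd_self] using hN n n hn hn

theorem exists_eventually_eq_of_finite {α β : Type*} (U : Ultrafilter α) (f : α → β) {s : Set β}
    (hs : s.Finite) (hf : ∀ a, f a ∈ s) : ∃ b, ∀ᶠ a in U, f a = b := by
  obtain ⟨b, -, hb⟩ := Ultrafilter.eq_pure_of_finite_mem (f := U.map f) hs
    (Filter.mem_map.2 (Filter.univ_mem' hf))
  refine ⟨b, ?_⟩
  have : {b} ∈ U.map f := by rw [hb]; exact Ultrafilter.mem_pure.2 rfl
  exact this

variable {S : SymGenSet Γ} {V E : Type*} (A : StronglyMarkov S V E)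

theorem isWordGeodesic_terminus {l : List E} (hl : A.IsPath l) :
    IsWordGeodesic S (fun i => A.terminus (l.take i)) l.length :=
  fun i j hij hj => A.geodesic l hl i j hij hj

theorem terminus_take_succ {l : List E} {i : ℕ} {e : E} (he : l[i]? = some e) :
    A.terminus (l.take (i + 1)) = A.terminus (l.take i) * A.label e := by
  rw [List.take_add_one, terminus_append, he]
  simp [Automaton.terminus]

/-- A family of paths of the automaton with marked positions further and further from both
extremities accumulates on a bilateral path. -/
theorem exists_biPath_limit [Finite E] (l : ℕ → List E) (p : ℕ → ℕ) (hl : ∀ k, A.IsPath (l k))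
    (hp : Tendsto p atTop atTop) (hq : Tendsto (fun k => (l k).length - p k) atTop atTop)
    (U : Ultrafilter ℕ) (hU : (U : Filter ℕ) ≤ atTop) :
    ∃ ω : BiPath A, ∀ j : ℤ, ∀ᶠ k in U, 0 ≤ p k + j ∧ (l k)[((p k : ℤ) + j).toNat]? = some (ω.1 j) := by
  have hex : ∀ j : ℤ, ∃ e : E, ∀ᶠ k in U, 0 ≤ p k + j ∧ (l k)[((p k : ℤ) + j).toNat]? = some e := by
    intro j
    -- The edge at offset `j` takes finitely many values, so it is constant along `U`; it is not
    -- `none` because the marked positions move away from both ends.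
    obtain ⟨o, ho⟩ := exists_eventually_eq_of_finite U (fun k => (l k)[((p k : ℤ) + j).toNat]?)
      (Set.finite_univ (α := Option E)) (fun _ => trivial)
    have h1 := hU (hp.eventually (eventually_ge_atTop j.natAbs))
    have h2 := hU (hq.eventually (eventually_gt_atTop j.natAbs))
    obtain ⟨k, hk, hk1, hk2⟩ := (ho.and (Filter.Eventually.and h1 h2)).exists
    have hlt : ((p k : ℤ) + j).toNat < (l k).length := by
      have hk1' : j.natAbs ≤ p k := hk1
      have hk2' : j.natAbs < (l k).length - p k := hk2
      omega
    rw [List.getElem?_eq_getElem hlt] at hk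
    refine ⟨_, (Filter.Eventually.and ho h1).mono fun k' hk' => ⟨?_, hk'.1.trans hk.symm⟩⟩
    have := hk'.2
    omega
  choose ω hω using hex
  refine ⟨⟨ω, fun i => ?_⟩, hω⟩
  obtain ⟨k, ⟨hk1, hk2⟩, hk3, hk4⟩ := ((hω i).and (hω (i + 1))).exists
  have hidx : ((p k : ℤ) + (i + 1)).toNat = ((p k : ℤ) + i).toNat + 1 := by omega
  rw [hidx] at hk4
  obtain ⟨h3, h3'⟩ := List.getElem?_eq_some_iff.1 hk2
  obtain ⟨h4, h4'⟩ := List.getElem?_eq_some_iff.1 hk4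
  rw [← h3', ← h4']
  exact List.isChain_iff_getElem.1 (hl k) _ h4

theorem HypComparison.exists_smul_wStar [Finite E] {d : LeftInvMetric Γ} {δ M c : ℝ}
    (h : HypComparison S d δ M c) {ξ η : Boundary (wordMetric S)} (hne : ξ ≠ η) :
    ∃ (g : Γ) (ω : BiPath A), ξ = g • xiMinus A ω ∧ η = g • xiPlus A ω := by
  induction ξ using Quot.ind with | mk x => ?_
  induction η using Quot.ind with | mk y => ?_
  have hxy : ¬ TendToSamePoint d x.1 y.1 := fun hxy => hne (h.boundary_mk_eq_iff.2 hxy)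
  rw [tendToSamePoint_iff] at hxy
  push Not at hxy
  obtain ⟨B, hB⟩ := hxy
  choose a b ha hb hab using hB
  obtain ⟨K, hK, hclose⟩ := h.exists_dist_le_of_gromovProd_le
  have hM := h.one_le
  have hpath : ∀ k, ∃ l, A.IsPath l ∧ A.terminus l = (x.1 (a k))⁻¹ * y.1 (b k) := fun k => by
    obtain ⟨l, hl, hl'⟩ := A.bijective.surjOn (Set.mem_univ ((x.1 (a k))⁻¹ * y.1 (b k)))
    exact ⟨l, hl.1, hl'⟩
  choose l hl hterm using hpath
  have hgeo : ∀ k, IsWordGeodesic S (fun i => x.1 (a k) * A.terminus ((l k).take i))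
      (l k).length := fun k => (isWordGeodesic_terminus A (hl k)).mul_left _
  have hzero : ∀ k, x.1 (a k) * A.terminus ((l k).take 0) = x.1 (a k) := fun k => by
    simp [Automaton.terminus]
  have hend : ∀ k, x.1 (a k) * A.terminus ((l k).take (l k).length) = y.1 (b k) := fun k => by
    rw [List.take_length, hterm, mul_inv_cancel_left]
  -- Distinct boundary points give pairs with Gromov product below `B`, so the geodesics joining
  -- them pass near the identity.
  have hnear : ∀ k, ∃ i ≤ (l k).length,
      d.dist 1 (x.1 (a k) * A.terminus ((l k).take i)) ≤ B + K := fun k =>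
    hclose _ _ 1 B (hgeo k) (by simpa only [hzero, hend] using (hab k).le)
  choose p hp hpd using hnear
  set R := M * (B + K) + c with hR
  have hpR : ∀ k, (wordMetric S).dist 1 (x.1 (a k) * A.terminus ((l k).take (p k))) ≤ R :=
    fun k => (h.word_le _ _).trans (by
      have := mul_le_mul_of_nonneg_left (hpd k) (zero_le_one.trans hM)
      linarith)
  have hx := tendsto_dist_one (x.2.comp ha ha)
  have hy := tendsto_dist_one (y.2.comp hb hb)
  have hpt : Tendsto p atTop atTop := by
    refine tendsto_natCast_atTop_iff.1 (tendsto_atTop_mono (fun k => ?_)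
      (tendsto_atTop_add_const_right _ (-R) hx))
    have h1 := hgeo k 0 (p k) (Nat.zero_le _) (hp k)
    simp only [hzero] at h1
    have h2 := (wordMetric S).dist_triangle 1 (x.1 (a k) * A.terminus ((l k).take (p k)))
      (x.1 (a k))
    rw [(wordMetric S).dist_comm (_ * _) (x.1 (a k)), h1] at h2
    have := hpR k
    push_cast at h2
    linarith
  have hqt : Tendsto (fun k => (l k).length - p k) atTop atTop := by
    refine tendsto_natCast_atTop_iff.1 (tendsto_atTop_mono (fun k => ?_)
      (tendsto_atTop_add_const_right _ (-R) hy))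
    have h1 := hgeo k (p k) (l k).length (hp k) le_rfl
    simp only [hend] at h1
    have h2 := (wordMetric S).dist_triangle 1 (x.1 (a k) * A.terminus ((l k).take (p k)))
      (y.1 (b k))
    rw [h1] at h2
    have := hpR k
    rw [Nat.cast_sub (hp k)]
    linarith
  have hU : (hyperfilter ℕ : Filter ℕ) ≤ atTop := Nat.hyperfilter_le_atTop
  obtain ⟨ω, hω⟩ := exists_biPath_limit A l p hl hpt hqt (hyperfilter ℕ) hU
  -- The marked points lie in a finite ball, so they are constant along the ultrafilter; their value
  -- is the translating element.
  obtain ⟨g, hg⟩ := exists_eventually_eq_of_finite (hyperfilter ℕ)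
    (fun k => x.1 (a k) * A.terminus ((l k).take (p k))) (finite_wordBall S R) hpR
  have hfwd : ∀ n : ℕ, ∀ᶠ k in (hyperfilter ℕ : Filter ℕ), p k + n ≤ (l k).length ∧
      g * fwd A ω n = x.1 (a k) * A.terminus ((l k).take (p k + n)) := by
    intro n
    induction n with
    | zero =>
      filter_upwards [hg] with k hk
      exact ⟨hp k, by simp [fwd, hk]⟩
    | succ n ih =>
      filter_upwards [ih, hω n] with k hk hk'
      have hidx : ((p k : ℤ) + n).toNat = p k + n := by omega
      rw [hidx] at hk'
      obtain ⟨hlt, -⟩ := List.getElem?_eq_some_iff.1 hk'.2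
      refine ⟨by omega, ?_⟩
      rw [← add_assoc, terminus_take_succ A hk'.2, fwd, ← mul_assoc, hk.2, mul_assoc]
  have hbwd : ∀ n : ℕ, ∀ᶠ k in (hyperfilter ℕ : Filter ℕ), n ≤ p k ∧
      g * bwd A ω n = x.1 (a k) * A.terminus ((l k).take (p k - n)) := by
    intro n
    induction n with
    | zero =>
      filter_upwards [hg] with k hk
      exact ⟨Nat.zero_le _, by simp [bwd, hk]⟩
    | succ n ih =>
      filter_upwards [ih, hω (-((n : ℤ) + 1))] with k hk hk'
      have hidx : ((p k : ℤ) + -((n : ℤ) + 1)).toNat = p k - (n + 1) := by omega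
      rw [hidx] at hk'
      refine ⟨by omega, ?_⟩
      have hsucc := terminus_take_succ A hk'.2
      rw [show p k - (n + 1) + 1 = p k - n by omega] at hsucc
      rw [bwd, ← mul_assoc, hk.2, hsucc, mul_assoc, mul_assoc, mul_inv_cancel, mul_one]
  refine ⟨g, ω, ?_, ?_⟩
  · refine (h.boundary_mk_eq_iff.2 (TendToSamePoint.symm ?_) :
      Boundary.mk _ x = Boundary.mk _ ⟨fun n => g * bwd A ω n, _⟩)
    refine h.tendToSamePoint_of_frequently (h.tendToSamePoint_word_iff.1 x.2) fun B' => ?_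
    obtain ⟨N, hN⟩ := exists_nat_ge (B' + (wordMetric S).dist g 1)
    refine ⟨N, fun n hn k₀ => ?_⟩
    obtain ⟨k, ⟨hk1, hk2⟩, hk3, hk4⟩ :=
      ((hbwd n).and (hg.and (hU (eventually_ge_atTop k₀)))).exists
    refine ⟨a k, (show k₀ ≤ k from hk4).trans (ha k), ?_⟩
    -- For suitable late `k`, the point `g * bwd A ω n` lies on the geodesic from `g` to `x (a k)`,
    -- at distance `n` from `g`.
    have h1 := (hgeo k).gromovProd_origin (Nat.sub_le (p k) n) (hp k)
    simp only [hzero, hk3, ← hk2] at h1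
    rw [Nat.cast_sub hk1] at h1
    have h2 := gromovProd_le_add_dist_base (wordMetric S) g 1 (g * bwd A ω n) (x.1 (a k))
    have : (N : ℝ) ≤ n := by exact_mod_cast hn
    linarith
  · refine (h.boundary_mk_eq_iff.2 (TendToSamePoint.symm ?_) :
      Boundary.mk _ y = Boundary.mk _ ⟨fun n => g * fwd A ω n, _⟩)
    refine h.tendToSamePoint_of_frequently (h.tendToSamePoint_word_iff.1 y.2) fun B' => ?_
    obtain ⟨N, hN⟩ := exists_nat_ge (B' + (wordMetric S).dist g 1)
    refine ⟨N, fun n hn k₀ => ?_⟩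
    obtain ⟨k, ⟨hk1, hk2⟩, hk3, hk4⟩ :=
      ((hfwd n).and (hg.and (hU (eventually_ge_atTop k₀)))).exists
    refine ⟨b k, (show k₀ ≤ k from hk4).trans (hb k), ?_⟩
    have h1 := (hgeo k).gromovProd_end (Nat.le_add_right (p k) n) hk1
    simp only [hend, hk3, ← hk2] at h1
    push_cast at h1
    have h2 := gromovProd_le_add_dist_base (wordMetric S) g 1 (g * fwd A ω n) (y.1 (b k))
    have : (N : ℝ) ≤ n := by exact_mod_cast hn
    linarith

theorem HypComparison.surjective_codingMap [Finite E] {d : LeftInvMetric Γ} {δ M c : ℝ}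
    (h : HypComparison S d δ M c) (hs : IsStronglyHyperbolic d) (N : ℕ) :
    Function.Surjective (h.codingMap A hs N) := by
  intro q
  induction q using Quot.ind with | mk q => ?_
  obtain ⟨⟨⟨ξ, η⟩, hne⟩, t⟩ := q
  obtain ⟨g, ω, h1, h2⟩ := h.exists_smul_wStar A hne
  refine ⟨Suspension.mk A d N ω (t + cocycle S d g (wStar A ω)), ?_⟩
  refine (h.flowSpace_mk_eq_iff hs).2 ⟨g, Prod.ext (Subtype.ext (Prod.ext h1 h2)) ?_⟩
  simp [lineAct]

end Surjectivity

/-! ### Fibres of the coding -/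

section Fibres

variable {Γ : Type*} [Group Γ] {S : SymGenSet Γ} {V E : Type*} (A : StronglyMarkov S V E)

/-- Prepending a path from the initial state to `v` reduces this to the injectivity of `terminus` on
initial paths. -/
theorem eq_of_terminus_eq {l l' : List E} {v : V} (hl : A.IsPath l) (hl' : A.IsPath l')
    (hv : ∀ e ∈ l.head?, A.src e = v) (hv' : ∀ e ∈ l'.head?, A.src e = v)
    (h : A.terminus l = A.terminus l') : l = l' := by
  obtain ⟨l₀, ⟨hp, hi⟩, hend⟩ := A.reachable v
  have key : ∀ m : List E, A.IsPath m → (∀ e ∈ m.head?, A.src e = v) →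
      A.IsInitialPath (l₀ ++ m) := by
    intro m hm hmv
    refine ⟨List.isChain_append.2 ⟨hp, hm, fun e he e' he' => ?_⟩, fun e he => ?_⟩
    · rw [hmv e' he', ← hend, Automaton.endVertex, Option.mem_def.1 he]
      rfl
    · rw [List.head?_append] at he
      rcases l₀ with _ | ⟨a, l₁⟩
      · rw [hmv e (by simpa using he), ← hend]
        rfl
      · exact hi e (by simpa using he)
  refine List.append_cancel_left (A.bijective.injOn (key l hl hv) (key l' hl' hv') ?_)
  rw [terminus_append, terminus_append, h]

variable {A} in
theorem biPath_apply_eq {ω ω' : BiPath A} {g g' : Γ} {n : ℕ}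
    (hb : g * bwd A ω n = g' * bwd A ω' n) (hf : g * fwd A ω n = g' * fwd A ω' n)
    (hsrc : A.src (ω.1 (-n)) = A.src (ω'.1 (-n))) {i : ℤ} (hi : i.natAbs < n) :
    ω.1 i = ω'.1 i := by
  have hhead : ∀ ω : BiPath A, ∀ e ∈ (segment A ω (-n) (n + n)).head?,
      A.src e = A.src (ω.1 (-n)) := by
    intro ω e he
    obtain ⟨k, hk⟩ : ∃ k, n + n = k + 1 := ⟨n + n - 1, by omega⟩
    rw [hk, segment, List.range_succ_eq_map] at he
    simp only [List.map_cons, List.head?_cons, Option.mem_def, Option.some.injEq] at he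
    rw [← he]
    simp
  have hterm : A.terminus (segment A ω (-n) (n + n)) = A.terminus (segment A ω' (-n) (n + n)) := by
    have h1 := bwd_mul_terminus_add A ω n n
    have h2 := bwd_mul_terminus_add A ω' n n
    refine mul_left_cancel (a := g * bwd A ω n) ?_
    rw [mul_assoc, h1, hf, hb, mul_assoc, h2]
  have hseg := eq_of_terminus_eq A (isPath_segment A ω _ _) (isPath_segment A ω' _ _)
    (fun e he => (hhead ω e he).trans hsrc) (hhead ω') hterm
  have := List.map_inj_left.1 hseg (i + n).toNat (List.mem_range.2 (by omega))
  have hidx : -(n : ℤ) + ((i + n).toNat : ℤ) = i := by omega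
  rwa [hidx] at this

variable {d : LeftInvMetric Γ} {δ M c : ℝ}

namespace HypComparison

theorem smul_xiMinus_eq_iff (h : HypComparison S d δ M c) (g : Γ) (ω ω' : BiPath A) :
    g • xiMinus A ω = xiMinus A ω' ↔ TendToSamePoint d (fun n => g * bwd A ω n) (bwd A ω') :=
  h.smul_boundary_mk_eq_iff g

theorem smul_xiPlus_eq_iff (h : HypComparison S d δ M c) (g : Γ) (ω ω' : BiPath A) :
    g • xiPlus A ω = xiPlus A ω' ↔ TendToSamePoint d (fun n => g * fwd A ω n) (fwd A ω') :=
  h.smul_boundary_mk_eq_iff g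

/-- Geodesic rays issuing from nearby points and with the same limit fellow travel. -/
theorem exists_fellow_travel (h : HypComparison S d δ M c) (R : ℝ) :
    ∃ R' : ℝ, ∀ x y : ℕ → Γ, (∀ n, IsWordGeodesic S x n) → (∀ n, IsWordGeodesic S y n) →
      TendToSamePoint d x y → (wordMetric S).dist (x 0) (y 0) ≤ R →
      ∀ n, (wordMetric S).dist (x n) (y n) ≤ R' := by
  obtain ⟨K, hK, hgeo⟩ := h.exists_gromovProd_le_of_geodesic
  obtain ⟨K₁, hK₁, hclose⟩ := h.exists_dist_le_of_gromovProd_le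
  have hδ := h.delta_nonneg
  have hM := h.one_le
  set R₁ := M * (K + M * R + δ + 1 + K₁) + c with hR₁
  refine ⟨2 * R₁ + R, fun x y hx hy hxy h0 n => ?_⟩
  obtain ⟨N, hN⟩ := hxy.exists_forall_le (x n) (K + M * R + 1 + δ)
  set k := max N n with hk
  have h1 := hN k k (le_max_left _ _) (le_max_left _ _)
  have h2 := hgeo x k n (hx k) (le_max_right _ _)
  have h3 : gromovProd d (x n) (y 0) (x k) ≤ K + M * R := by
    have e1 := gromovProd_le_add_dist_left d (x n) (y 0) (x 0) (x k)
    have e2 := h.dist_le (y 0) (x 0)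
    rw [(wordMetric S).dist_comm] at e2
    have e3 : M * (wordMetric S).dist (x 0) (y 0) ≤ M * R := by gcongr
    linarith
  -- Far out, `x k` and `y k` have a large product seen from `x n`, so `y k` can replace `x k` in
  -- the bound `h3`.
  have h4 : gromovProd d (x n) (y 0) (y k) ≤ K + M * R + δ + 1 := by
    by_contra! hlt
    have := h.le_gromovProd_of_le (B := K + M * R + 1) (x := y 0) (y := x k) (z := y k) (w := x n)
      (by linarith) (by rw [gromovProd_comm]; linarith)
    linarith
  obtain ⟨m, hm, hd⟩ := hclose y k (x n) _ (hy k) h4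
  have h5 : (wordMetric S).dist (x n) (y m) ≤ R₁ := by
    have e1 := h.word_le (x n) (y m)
    have e2 : M * d.dist (x n) (y m) ≤ M * (K + M * R + δ + 1 + K₁) := by gcongr
    linarith
  -- Comparing distances to the origins of the rays shows that `m` and `n` differ by at most `R₁ +
  -- R`.
  have hxn := hx n 0 n (Nat.zero_le _) le_rfl
  have hym := hy m 0 m (Nat.zero_le _) le_rfl
  have t1 := (wordMetric S).dist_triangle (x 0) (y 0) (x n)
  have t2 := (wordMetric S).dist_triangle (y 0) (y m) (x n)
  have t3 := (wordMetric S).dist_triangle (y 0) (x 0) (y m)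
  have t4 := (wordMetric S).dist_triangle (x 0) (x n) (y m)
  have t5 := (wordMetric S).dist_triangle (x n) (y m) (y n)
  rw [(wordMetric S).dist_comm (y m) (x n)] at t2
  rw [(wordMetric S).dist_comm (y 0) (x 0)] at t3
  push_cast at hxn hym
  rcases le_total m n with hmn | hmn
  · have := hy n m n hmn le_rfl
    linarith
  · have := hy m n m hmn le_rfl
    rw [(wordMetric S).dist_comm] at this
    linarith

/-- An element of the group that maps the extremities of a coded geodesic to those of another one,
with a bounded value of the cocycle, is bounded. -/
theorem exists_dist_le_of_cocycle_le (h : HypComparison S d δ M c) (hs : IsStronglyHyperbolic d)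
    (a : ℝ) : ∃ R : ℝ, ∀ (ω ω' : BiPath A) (g : Γ), g • xiMinus A ω = xiMinus A ω' →
      g • xiPlus A ω = xiPlus A ω' → |cocycle S d g (wStar A ω)| ≤ a → d.dist 1 g ≤ R := by
  obtain ⟨K, hK, hbf⟩ := h.exists_gromovProd_bwd_fwd_le A
  have hδ := h.delta_nonneg
  refine ⟨2 * K + 2 * δ + (a + 1 + (K + 2 * δ + 1)), fun ω ω' g hm hp ha => ?_⟩
  have hz : TendToSamePoint d (fun n => g * bwd A ω n) (bwd A ω') :=
    (h.smul_xiMinus_eq_iff A g ω ω').1 hm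
  have hy : TendToSamePoint d (fun n => g * fwd A ω n) (fwd A ω') :=
    (h.smul_xiPlus_eq_iff A g ω ω').1 hp
  have hlim := h.tendsto_cocycle hs g⁻¹
    ⟨bwd A ω', tendToSamePoint_of_ray _ rfl (bwd_ray A ω')⟩
    ⟨fwd A ω', tendToSamePoint_of_ray _ rfl (fwd_ray A ω')⟩
  have hval : cocycle S d g⁻¹ (xiMinus A ω', xiPlus A ω') = - cocycle S d g (wStar A ω) := by
    have := h.cocycle_mul hs g⁻¹ g (wStar A ω)
    rw [inv_mul_cancel, h.cocycle_one hs] at this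
    rw [← hm, ← hp]
    simp only [wStar] at this ⊢
    linarith
  obtain ⟨N, hN⟩ := hz.exists_forall_le g (K + 1 + δ)
  obtain ⟨N', hN'⟩ := hy.exists_forall_le g (K + 1 + δ + δ)
  have hev := hlim.eventually (Metric.ball_mem_nhds _ one_pos)
  obtain ⟨n, hn, hnN, hnN'⟩ :=
    (hev.and ((eventually_ge_atTop N).and (eventually_ge_atTop N'))).exists
  change dist _ (cocycle S d g⁻¹ (xiMinus A ω', xiPlus A ω')) < 1 at hn
  rw [hval, Real.dist_eq, abs_lt] at hn
  rw [abs_le] at ha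
  simp only [inv_inv] at hn
  -- The translated geodesic passes through `g` and has the same limits as that of `ω'`, so `g` is
  -- near the latter as well.
  have h1 : gromovProd d g (bwd A ω' n) (fwd A ω' n) ≤ K + 2 * δ + 1 := by
    by_contra! hlt
    have e1 := h.le_gromovProd_of_le (B := K + 1 + δ) (x := bwd A ω' n) (y := g * fwd A ω n)
      (z := fwd A ω' n) (w := g) (by linarith)
      (by rw [gromovProd_comm]; linarith [hN' n n hnN' hnN'])
    have e2 := h.le_gromovProd_of_le (B := K + 1) (x := g * bwd A ω n) (y := g * fwd A ω n)
      (z := bwd A ω' n) (w := g) (hN n n hnN hnN) e1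
    have e3 := gromovProd_mul_left d g 1 (bwd A ω n) (fwd A ω n)
    rw [mul_one] at e3
    linarith [hbf ω n n]
  have h2 := hbf ω' n n
  have h3 := gromovProd_nonneg d 1 (bwd A ω' n) (fwd A ω' n)
  -- The cocycle controls the difference of the two Busemann terms of `g`, and `h1` bounds their sum
  -- from above, so each is bounded above. If `g` were far from `1`, both ends would have a large
  -- product with it, hence with each other, against `h2`.
  have h4 : d.dist 1 g - (a + 1 + (K + 2 * δ + 1)) ≤ 2 * gromovProd d 1 (bwd A ω' n) g := by
    simp only [gromovProd, d.dist_comm (bwd A ω' n) g] at h1 h3 ⊢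
    linarith [hn.2, ha.1]
  have h5 : d.dist 1 g - (a + 1 + (K + 2 * δ + 1)) ≤ 2 * gromovProd d 1 g (fwd A ω' n) := by
    simp only [gromovProd] at h1 h3 ⊢
    linarith [hn.1, ha.2]
  by_contra! hlt
  have := h.le_gromovProd_of_le (B := K + (d.dist 1 g - (2 * K + 2 * δ +
    (a + 1 + (K + 2 * δ + 1)))) / 2) (x := bwd A ω' n) (y := fwd A ω' n)
    (z := g) (w := 1) (by linarith) (by linarith)
  linarith

/-- The coded geodesics that pass near the origin and have given extremities are finitely many,
with a uniform bound. -/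
theorem exists_encard_le [Finite V] (h : HypComparison S d δ M c) (R : ℝ) :
    ∃ C : ℕ, ∀ ω₀ : BiPath A, {q : Γ × BiPath A | q.1 • xiMinus A q.2 = xiMinus A ω₀ ∧
      q.1 • xiPlus A q.2 = xiPlus A ω₀ ∧ (wordMetric S).dist 1 q.1 ≤ R}.encard ≤ C := by
  obtain ⟨R', hR'⟩ := h.exists_fellow_travel R
  set F : Set (Γ × Γ × V) := {g : Γ | (wordMetric S).dist 1 g ≤ R'} ×ˢ
    ({g : Γ | (wordMetric S).dist 1 g ≤ R'} ×ˢ (Set.univ : Set V)) with hF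
  have hFfin : F.Finite :=
    (finite_wordBall S R').prod ((finite_wordBall S R').prod Set.finite_univ)
  refine ⟨F.ncard, fun ω₀ => ?_⟩
  by_contra! hlt
  obtain ⟨t, ht, htcard⟩ := Set.exists_subset_encard_eq (Order.add_one_le_of_lt hlt)
  have htfin : t.Finite := Set.finite_of_encard_eq_coe (k := F.ncard + 1) (by
    rw [htcard]; push_cast; rfl)
  -- Displacements from `ω₀` at times `-n` and `n`, and the vertex at time `-n`. By fellow
  -- travelling they lie in the finite set `F`, whose cardinality does not depend on `ω₀`. One large
  -- `n` separates any finite set of pairs, so `|F| + 1` of them cannot exist.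
  let φ : ℕ → Γ × BiPath A → Γ × Γ × V := fun n q =>
    ((bwd A ω₀ n)⁻¹ * (q.1 * bwd A q.2 n), (fwd A ω₀ n)⁻¹ * (q.1 * fwd A q.2 n),
      A.src (q.2.1 (-n)))
  have hsep : ∀ q q' : Γ × BiPath A, ∀ᶠ n in atTop, φ n q = φ n q' → q = q' := by
    rintro ⟨g, ω⟩ ⟨g', ω'⟩
    have hinj : ∀ n, φ n (g, ω) = φ n (g', ω') → g * bwd A ω n = g' * bwd A ω' n ∧
        g * fwd A ω n = g' * fwd A ω' n ∧ A.src (ω.1 (-n)) = A.src (ω'.1 (-n)) := by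
      intro n hn
      simp only [φ, Prod.mk.injEq, mul_right_inj] at hn
      exact hn
    by_cases hω : ω = ω'
    · subst hω
      refine Eventually.of_forall fun n hn => ?_
      rw [mul_right_cancel (hinj n hn).1]
    · obtain ⟨i, hi⟩ : ∃ i, ω.1 i ≠ ω'.1 i := by
        by_contra! hall
        exact hω (Subtype.ext (funext hall))
      filter_upwards [eventually_gt_atTop i.natAbs] with n hn heq
      obtain ⟨e1, e2, e3⟩ := hinj n heq
      exact absurd (biPath_apply_eq e1 e2 e3 hn) hi
  obtain ⟨n, hn⟩ : ∃ n, ∀ q ∈ t, ∀ q' ∈ t, φ n q = φ n q' → q = q' := by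
    refine Eventually.exists (f := atTop) ?_
    rw [Filter.eventually_all_finite htfin]
    intro q _
    rw [Filter.eventually_all_finite htfin]
    exact fun q' _ => hsep q q'
  have hmaps : Set.MapsTo (φ n) t F := by
    rintro ⟨g, ω⟩ hq
    obtain ⟨h1, h2, h3⟩ := ht hq
    have hg : (wordMetric S).dist 1 (g * 1) ≤ R := by rwa [mul_one]
    have hsub : ∀ u v : Γ, (wordMetric S).dist 1 (u⁻¹ * v) = (wordMetric S).dist u v :=
      fun u v => by
        rw [← (wordMetric S).dist_mul_left u 1, mul_one, mul_inv_cancel_left]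
    refine ⟨?_, ?_, trivial⟩
    · refine (hsub _ _).trans_le (hR' _ (fun n => g * bwd A ω n) (isWordGeodesic_bwd A ω₀)
        (fun n => (isWordGeodesic_bwd A ω n).mul_left g) ?_ hg n)
      exact ((h.smul_xiMinus_eq_iff A g ω ω₀).1 h1).symm
    · refine (hsub _ _).trans_le (hR' _ (fun n => g * fwd A ω n) (isWordGeodesic_fwd A ω₀)
        (fun n => (isWordGeodesic_fwd A ω n).mul_left g) ?_ hg n)
      exact ((h.smul_xiPlus_eq_iff A g ω ω₀).1 h2).symm
  have hle := Set.encard_le_encard_of_injOn hmaps (fun q hq q' hq' => hn q hq q' hq')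
  rw [htcard, ← hFfin.cast_ncard_eq] at hle
  exact absurd (show F.ncard + 1 ≤ F.ncard by exact_mod_cast hle) (by omega)

end HypComparison

theorem Suspension.mk_add_roof (N : ℕ) (ω : BiPath A) (t : ℝ) :
    Suspension.mk A d N ω (t + roof A d N ω) = Suspension.mk A d N ((shift A)^[N] ω) t :=
  Quot.sound ⟨ω, t, rfl, rfl⟩

variable {A} in
theorem Suspension.exists_rep {N : ℕ} {c₁ c₂ : ℝ} (hc₁ : 0 < c₁)
    (hroof : ∀ ω : BiPath A, roof A d N ω ∈ Set.Icc c₁ c₂) (p : Suspension A d N) :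
    ∃ (ω : BiPath A) (s : ℝ), p = Suspension.mk A d N ω s ∧ 0 ≤ s ∧ s ≤ c₂ := by
  -- Each identification moves the time by at least `c₁` towards `[0, c₂]`, and by at most `c₂`, so
  -- it never jumps over the interval.
  have key : ∀ (k : ℕ) (ω : BiPath A) (s : ℝ), -(k * c₁) ≤ s → s ≤ k * c₁ + c₂ →
      ∃ (ω' : BiPath A) (s' : ℝ), Suspension.mk A d N ω s = Suspension.mk A d N ω' s' ∧
        0 ≤ s' ∧ s' ≤ c₂ := by
    intro k
    induction k with
    | zero => intro ω s h1 h2; exact ⟨ω, s, rfl, by simpa using h1, by simpa using h2⟩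
    | succ k ih =>
      intro ω s h1 h2
      push_cast at h1 h2
      have hk : 0 ≤ k * c₁ := by positivity
      rcases lt_or_ge s 0 with hs | hs
      · obtain ⟨ω', rfl⟩ := (shift_surjective A).iterate N ω
        rw [← Suspension.mk_add_roof]
        have := hroof ω'
        exact ih _ _ (by linarith [this.1]) (by linarith [this.2])
      · rcases le_or_gt s c₂ with hs' | hs'
        · exact ⟨ω, s, rfl, hs, hs'⟩
        · have := hroof ω
          rw [← sub_add_cancel s (roof A d N ω), Suspension.mk_add_roof]
          exact ih _ _ (by linarith [this.2]) (by linarith [this.1])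
  induction p using Quot.ind with
  | mk p =>
    obtain ⟨ω, s⟩ := p
    obtain ⟨k, hk⟩ := exists_nat_ge (|s| / c₁)
    rw [div_le_iff₀ hc₁] at hk
    have hc₂ : 0 ≤ c₂ := hc₁.le.trans ((hroof ω).1.trans (hroof ω).2)
    exact key k ω s (by linarith [neg_abs_le s]) (by linarith [le_abs_self s])

theorem HypComparison.exists_fibre_encard_le [Finite V] (h : HypComparison S d δ M c)
    (hs : IsStronglyHyperbolic d) {N : ℕ} (hN : IsRoofTime A d N) :
    ∃ C : ℕ, 1 ≤ C ∧ ∀ x : FlowSpace S d, (h.codingMap A hs N ⁻¹' {x}).encard ≤ C := by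
  obtain ⟨-, c₁, c₂, hc₁, hc₂, hroof⟩ := hN
  have hM := h.one_le
  obtain ⟨R, hR⟩ := h.exists_dist_le_of_cocycle_le A hs c₂
  obtain ⟨C, hC⟩ := h.exists_encard_le A (M * R + c)
  -- The successor only serves to make the bound at least `1`.
  refine ⟨C + 1, Nat.le_add_left _ _, fun x => ?_⟩
  refine le_trans ?_ (Nat.cast_le.2 (Nat.le_succ C))
  rcases (h.codingMap A hs N ⁻¹' {x}).eq_empty_or_nonempty with hemp | ⟨p₀, hp₀⟩
  · simp [hemp]
  obtain ⟨ω₀, s₀, rfl, hs0, hs0'⟩ := Suspension.exists_rep hc₁ hroof p₀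
  have : Nonempty (BiPath A) := ⟨ω₀⟩
  -- Both times lie in `[0, c₂]` and their difference is the cocycle, which bounds `g`. The time of
  -- `p` can be recovered from `(g, ω)` and `s₀`, so the pair determines `p`.
  have hrep : ∀ p ∈ h.codingMap A hs N ⁻¹' {x}, ∃ q : Γ × BiPath A,
      (q.1 • xiMinus A q.2 = xiMinus A ω₀ ∧ q.1 • xiPlus A q.2 = xiPlus A ω₀ ∧
        (wordMetric S).dist 1 q.1 ≤ M * R + c) ∧
      p = Suspension.mk A d N q.2 (s₀ + cocycle S d q.1 (wStar A q.2)) := by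
    intro p hp
    obtain ⟨ω, s, rfl, hs1, hs1'⟩ := Suspension.exists_rep hc₁ hroof p
    obtain ⟨g, hg⟩ := (h.flowSpace_mk_eq_iff hs).1 (hp.trans hp₀.symm)
    have hm : xiMinus A ω₀ = g • xiMinus A ω := congrArg (fun q : LineSpace S => q.1.1.1) hg
    have hpl : xiPlus A ω₀ = g • xiPlus A ω := congrArg (fun q : LineSpace S => q.1.1.2) hg
    have ht : s₀ = s - cocycle S d g (wStar A ω) := congrArg (fun q : LineSpace S => q.2) hg
    refine ⟨(g, ω), ⟨hm.symm, hpl.symm, ?_⟩, ?_⟩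
    · have h1 := hR ω ω₀ g hm.symm hpl.symm (abs_le.2 ⟨by linarith, by linarith⟩)
      have h2 := mul_le_mul_of_nonneg_left h1 (zero_le_one.trans hM)
      linarith [h.word_le 1 g]
    · rw [ht, sub_add_cancel]
  choose! q hq hpq using hrep
  refine (Set.encard_le_encard_of_injOn (fun p hp => hq p hp) fun p hp p' hp' heq => ?_).trans
    (hC ω₀)
  rw [hpq p hp, hpq p' hp', heq]

end Fibres

end FlowCoding

theorem mainTheorem7 {Γ : Type*} [Group Γ] (hΓ : IsHyperbolicGroup Γ)
    (d : LeftInvMetric Γ) (hd : IsAdmissible d) (hstrong : IsStronglyHyperbolic d)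
    (S : SymGenSet Γ) {V E : Type*} [Finite V] [Finite E] (A : StronglyMarkov S V E) :
    (∃ N : ℕ, IsRoofTime A d N) ∧
    ∃ hne : ∀ ω : BiPath A, (wStar A ω).1 ≠ (wStar A ω).2,
      ∀ N : ℕ, IsRoofTime A d N →
        ∃ Pi : Suspension A d N → FlowSpace S d,
          (∀ (ω : BiPath A) (t : ℝ),
            Pi (Suspension.mk A d N ω t) = FlowSpace.mk S d (⟨wStar A ω, hne ω⟩, t)) ∧
          Continuous Pi ∧
          (∀ (t : ℝ) (p : Suspension A d N),
            Pi (Suspension.flow A d N t p) = FlowSpace.flow S d t (Pi p)) ∧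
          Function.Surjective Pi ∧
          ∃ C : ℕ, 1 ≤ C ∧ ∀ x : FlowSpace S d, (Pi ⁻¹' {x}).encard ≤ C := by
  obtain ⟨δ, M, c, h⟩ := hd.exists_hypComparison S
  refine ⟨h.exists_isRoofTime A hstrong, h.wStar_ne A, fun N hN => ?_⟩
  exact ⟨h.codingMap A hstrong N, fun _ _ => rfl, h.continuous_codingMap A hstrong N,
    h.codingMap_flow A hstrong N, h.surjective_codingMap A hstrong N,
    h.exists_fibre_encard_le A hstrong hN⟩
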